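/- \textbf{Setting.} Fix a signature of function symbols with arities, a set of variables, and a weight function $w$ from function symbols to $\mathbb{N}$. The weight $|t|$ of a term is the linear expression $\sum_f |t|_f\, w(f)+\sum_x |t|_x\, x$, where $|t|_p$ counts occurrences; a substitution $\sigma$ (moving only finitely many variables) acts on linear expressions by $\sigma(\alpha_0+\sum\alpha_i x_i)=\alpha_0+\sum\alpha_i|x_i\sigma|$. It is grounding for $e$ if $\sigma(e)$ is constant and every constant $|x\sigma|$ is at least the smallest weight of a constant symbol; $e>0$ (resp. $e\gtrsim 0$) means $\sigma(e)>0$ (resp. $\ge 0$) for all $\sigma$ grounding for $e$. Let $\succ$ be a Knuth--Bendix order (KBO, built from $w$ and a total precedence $\gg$), a lexicographic path order (LPO, built from a total precedence $\gg$), or any other relation on terms. Put $\sigma(s\,?\,t)={>}$ if $s\sigma\succ t\sigma$, ${=}$ if $s\sigma=t\sigma$, $\ngeq$ otherwise; and $\sigma(e\,?\,0)={>}$ if $\sigma(e)>0$, ${\geq}$ if otherwise $\sigma(e)\gtrsim0$, $\ngeq$ otherwise. \textbf{Diagrams.} A \emph{term ordering diagram} (TOD) is a finite directed acyclic graph with a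 single root (one outgoing edge), from which every node is reachable; a single exit node, reachable from every node and without outgoing edges; and otherwise \emph{term comparison nodes} $s\,?\,t$ (three outgoing edges, labeled $>,=,\ngeq$), \emph{positivity check nodes} $e\,?\,0$ (three outgoing edges, labeled $>,\geq,\ngeq$) and \emph{success nodes} labeled by an equality $l\simeq r$ (one outgoing edge). The nodes of the second and third kind are \emph{evaluation nodes}. A path is a \emph{$\sigma$-path} if it leaves each evaluation node labeled $c$ by the edge labeled $\sigma(c)$. A \emph{forcing function} is a partial function $F$ from paths starting at the root of a TOD to edge labels such that, for every $\sigma$ and every $\sigma$-path $n_0,\dots,n_i,n_{i+1}$ from the root, if $F(n_0,\dots,n_i)=\ell$ then the last edge of the path is labeled $\ell$. \textbf{Transformations} of a node $n$ labeled $s\,?\,t$ with $s=f(s_1,\dots,s_k)$, $t=g(t_1,\dots,t_m)$ and successors $n_1,n_2,n_3$ along $>,=,\ngeq$ replace $n$ as follows; nodes that lose all their incoming edges are removed repeatedly. If $\succ$ is a KBO: by the check $|s|-|t|\,?\,0$ with successors along $>,\geq,\ngeq$ equal to $(n_1,n_1,n_3)$ if $f\gg g$, to $(n_1,n_3,n_3)$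 if $g\gg f$, and to $(n_1,a_1,n_3)$ if $f=g$, where $a_i$ is a new node $s_i\,?\,t_i$ with successors $(n_1,a_{i+1},n_3)$ for $i\le k$, and $a_{k+1}=n_2$. If $\succ$ is an LPO: by $b_1$ if $f\gg g$, where $b_i$ is a new node $s\,?\,t_i$ with successors $(b_{i+1},n_3,n_3)$ for $i\le m$, and $b_{m+1}=n_1$; by $c_1$ if $g\gg f$, where $c_i$ is a new node $s_i\,?\,t$ with successors $(n_1,n_1,c_{i+1})$ for $i\le k$, and $c_{k+1}=n_3$; by $a_1$ if $f=g$, where $a_i$ is a new node $s_i\,?\,t_i$ with successors $(b_{i+1},a_{i+1},c_{i+1})$ for $i\le k$, $a_{k+1}=n_2$, and $b_i$ and $c_i$ are as before. \textbf{Retrieval algorithm.} The input is a TOD $D$, some of whose nodes may be marked visited, a query substitution $\sigma$, a forcing function $F$ and a set of deleted equalities. The algorithm starts at the successor of the root and repeats the following, where $\pi=n_0,\dots,n_k,n$ is the path followed so far and $n$ is the current node. \begin{enumerate} \item If $n$ is the exit node, stop and return the non-deleted equalities of the success nodes passed. \item If $n$ is a success node, go to its successor; in the variant that seeks one candidate only,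 stop if the equality of $n$ is not deleted, and return it. \item If $n$ is an unvisited evaluation node, first, if $n$ has more than one incoming edge, redirect the edge from $n_k$ along which $n$ was reached to a new copy of $n$ (with the same label and outgoing edges, unvisited), which becomes the current node $n$. Then: (a) if $F(\pi)=\ell$, redirect the edge from $n_k$ to $n$ to the $\ell$-successor of $n$, which becomes the current node, and repeatedly remove nodes without incoming edges; (b) if a KBO or LPO transformation (according to $\succ$) applies to $n$, apply it and continue at the node that has taken the place of $n$; (c) otherwise, mark $n$ visited. \item If $n$ is a visited evaluation node labeled $c$, go along its edge labeled $\sigma(c)$. \end{enumerate} \textbf{Lemma (Termination).} For every TOD, every set of visited marks, every query substitution, every forcing function and every set of deleted equalities, and for both variants, the retrieval algorithm terminates: it has no infinite run, and every run that cannot be continued has stopped by returning a result. -/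

import Mathlib

universe u v w

namespace TermOrderingDiagram

open FirstOrder

/-! ### Terms, substitutions, weights, KBO and LPO -/

/-- Function symbols (of all arities) of the signature. -/
abbrev Sym (L : FirstOrder.Language.{u, v}) : Type u := Σ n, L.Functions n

/-- A substitution: a map from variables to terms that moves only finitely many variables. -/
structure Subst (L : FirstOrder.Language.{u, v}) (V : Type w) where
  map : V → L.Term V
  finite_support : {x | map x ≠ .var x}.Finite

/-- Application `t σ` of a substitution to a term. -/
def Subst.app {L : FirstOrder.Language.{u, v}} {V : Type w} (σ : Subst L V) (t : L.Term V) : L.Term V :=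
  t.subst σ.map

/-- A precedence: a (strict) total order on the function symbols. -/
structure Precedence (L : FirstOrder.Language.{u, v}) where
  gt : Sym L → Sym L → Prop
  strictTotal : IsStrictTotalOrder (Sym L) gt

/-- Linear expressions over `V` with integer coefficients: (constant part, coefficients). -/
abbrev LinExpr (V : Type w) : Type w := ℤ × (V →₀ ℤ)

section Weights

variable {L : FirstOrder.Language.{u, v}} {V : Type w} (wt : Sym L → ℕ)

/-- The weight `|t|` of a term: every occurrence of a function symbol `f` contributes `wt f`, and
every occurrence of a variable `x` contributes `x`. -/
noncomputable def weight : L.Term V → LinExpr V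
  | .var x => (0, Finsupp.single x 1)
  | .func f ts => ((wt ⟨_, f⟩ : ℤ), 0) + ∑ i, weight (ts i)

/-- The smallest weight of a constant. -/
noncomputable def minConstWeight : ℕ := sInf {a | ∃ c : L.Functions 0, wt ⟨0, c⟩ = a}

/-- `σ(α₀ + α₁ x₁ + ... ) = α₀ + α₁ |x₁ σ| + ...`. -/
noncomputable def Subst.appLin (σ : Subst L V) (e : LinExpr V) : LinExpr V :=
  (e.1, 0) + e.2.sum fun x a => a • weight wt (σ.map x)

/-- `σ` is grounding for `e`: `σ(e)` has no variables, and `|xσ|` is at least the least weight of a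
constant whenever `|xσ|` is a constant expression. -/
def IsGrounding (σ : Subst L V) (e : LinExpr V) : Prop :=
  (σ.appLin wt e).2 = 0 ∧
    ∀ x, (weight wt (σ.map x)).2 = 0 → (minConstWeight wt : ℤ) ≤ (weight wt (σ.map x)).1

/-- `e > 0`. -/
def LinPos (e : LinExpr V) : Prop :=
  ∀ σ : Subst L V, IsGrounding wt σ e → 0 < (σ.appLin wt e).1

/-- `e ≳ 0`. -/
def LinNonneg (e : LinExpr V) : Prop :=
  ∀ σ : Subst L V, IsGrounding wt σ e → 0 ≤ (σ.appLin wt e).1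

/-- The Knuth-Bendix order. -/
inductive KBO (prec : Precedence L) : L.Term V → L.Term V → Prop
  | weight (s t : L.Term V) (h : LinPos wt (weight wt s - weight wt t)) : KBO prec s t
  | prec {k m : ℕ} (f : L.Functions k) (g : L.Functions m)
      (ss : Fin k → L.Term V) (ts : Fin m → L.Term V)
      (hw : LinNonneg wt (TermOrderingDiagram.weight wt (.func f ss) -
        TermOrderingDiagram.weight wt (.func g ts)))
      (hfg : prec.gt ⟨k, f⟩ ⟨m, g⟩) :
      KBO prec (.func f ss) (.func g ts)
  | lex {k : ℕ} (f : L.Functions k) (ss ts : Fin k → L.Term V) (i : Fin k)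
      (hw : LinNonneg wt (TermOrderingDiagram.weight wt (.func f ss) -
        TermOrderingDiagram.weight wt (.func f ts)))
      (hpre : ∀ j < i, ss j = ts j) (hi : KBO prec (ss i) (ts i)) :
      KBO prec (.func f ss) (.func f ts)

end Weights

/-- The lexicographic path order. -/
inductive LPO {L : FirstOrder.Language.{u, v}} {V : Type w} (prec : Precedence L) :
    L.Term V → L.Term V → Prop
  | lex {k : ℕ} (f : L.Functions k) (ss ts : Fin k → L.Term V) (i : Fin k)
      (hpre : ∀ j < i, ss j = ts j) (hi : LPO prec (ss i) (ts i))
      (hgt : ∀ j, i < j → LPO prec (.func f ss) (ts j)) :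
      LPO prec (.func f ss) (.func f ts)
  | prec {k m : ℕ} (f : L.Functions k) (g : L.Functions m)
      (ss : Fin k → L.Term V) (ts : Fin m → L.Term V)
      (hfg : prec.gt ⟨k, f⟩ ⟨m, g⟩) (hgt : ∀ j, LPO prec (.func f ss) (ts j)) :
      LPO prec (.func f ss) (.func g ts)
  | arg_eq {k : ℕ} (f : L.Functions k) (ss : Fin k → L.Term V) (i : Fin k) :
      LPO prec (.func f ss) (ss i)
  | arg_gt {k : ℕ} (f : L.Functions k) (ss : Fin k → L.Term V) (t : L.Term V) (i : Fin k)
      (hi : LPO prec (ss i) t) : LPO prec (.func f ss) t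

/-- The term ordering in use. The transformations specific to KBO (to LPO) are available exactly
when the ordering is a KBO (an LPO); for any other ordering only the generic ones are. -/
inductive TermOrder (L : FirstOrder.Language.{u, v}) (V : Type w)
  | kbo (prec : Precedence L)
  | lpo (prec : Precedence L)
  | other (r : L.Term V → L.Term V → Prop)

/-- The relation `s ≻ t`. -/
def TermOrder.gt {L : FirstOrder.Language.{u, v}} {V : Type w} (wt : Sym L → ℕ) :
    TermOrder L V → L.Term V → L.Term V → Prop
  | .kbo prec => KBO wt prec
  | .lpo prec => LPO prec
  | .other r => r

/-! ### Diagrams -/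

/-- Edge labels `>`, `=`, `≥`, `≱`. -/
inductive Lbl
  | gt | eq | geq | ngeq
  deriving DecidableEq

/-- The content of a node, including the target nodes of its outgoing edges. -/
inductive Node (L : FirstOrder.Language.{u, v}) (V : Type w)
  | root (next : ℕ)
  | exit
  /-- term comparison node, with the targets of its edges `>`, `=`, `≱` -/
  | comp (s t : L.Term V) (gt eq ngeq : ℕ)
  /-- positivity check node, with the targets of its edges `>`, `≥`, `≱` -/
  | pos (e : LinExpr V) (gt geq ngeq : ℕ)
  /-- success node labeled by the equality `l ≃ r` -/
  | success (l r : L.Term V) (next : ℕ)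

section Diagrams

variable {L : FirstOrder.Language.{u, v}} {V : Type w}

/-- The target of the outgoing edge with a given label; `none` is the label of the unlabeled edges,
those leaving the root and the success nodes. -/
def Node.target : Node L V → Option Lbl → Option ℕ
  | .root m, none => some m
  | .success _ _ m, none => some m
  | .comp _ _ a _ _, some .gt => some a
  | .comp _ _ _ b _, some .eq => some b
  | .comp _ _ _ _ c, some .ngeq => some c
  | .pos _ a _ _, some .gt => some a
  | .pos _ _ b _, some .geq => some b
  | .pos _ _ _ c, some .ngeq => some c
  | _, _ => none

/-- Change the target of each outgoing edge by `φ label oldTarget`. -/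
def Node.mapTargets (φ : Option Lbl → ℕ → ℕ) : Node L V → Node L V
  | .root m => .root (φ none m)
  | .exit => .exit
  | .comp s t a b c => .comp s t (φ (some .gt) a) (φ (some .eq) b) (φ (some .ngeq) c)
  | .pos e a b c => .pos e (φ (some .gt) a) (φ (some .geq) b) (φ (some .ngeq) c)
  | .success l r m => .success l r (φ none m)

/-- Evaluation nodes are the term comparison nodes and the positivity check nodes. -/
def Node.IsEval : Node L V → Prop
  | .comp .. => True
  | .pos .. => True
  | _ => False

variable (L V) in
/-- A rooted labeled directed graph with nodes named by natural numbers; `node v = none` says that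
there is no node named `v`. -/
structure Diagram where
  node : ℕ → Option (Node L V)
  root : ℕ

namespace Diagram

/-- The set of nodes. -/
def nodes (D : Diagram L V) : Set ℕ := {a | D.node a ≠ none}

/-- There is an edge labeled `ℓ` from `a` to `b`. -/
def Edge (D : Diagram L V) (a : ℕ) (ℓ : Option Lbl) (b : ℕ) : Prop :=
  ∃ c, D.node a = some c ∧ c.target ℓ = some b

/-- There is an edge from `a` to `b`. -/
def Adj (D : Diagram L V) (a b : ℕ) : Prop := ∃ ℓ, D.Edge a ℓ b

/-- There is a (possibly trivial) path from `a` to `b`. -/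
def Reach (D : Diagram L V) : ℕ → ℕ → Prop := Relation.ReflTransGen D.Adj

/-- Term ordering diagrams. The numbers and labels of outgoing edges are built into `Node`. -/
structure IsTOD (D : Diagram L V) : Prop where
  finite : D.nodes.Finite
  closed : ∀ a b, D.Adj a b → b ∈ D.nodes
  acyclic : ∀ a, ¬ Relation.TransGen D.Adj a a
  single_root : ∀ a, (∃ m, D.node a = some (.root m)) ↔ a = D.root
  reach_root : ∀ a ∈ D.nodes, D.Reach D.root a
  single_exit : ∃! x, D.node x = some .exit
  reach_exit : ∀ a ∈ D.nodes, ∀ x, D.node x = some .exit → D.Reach a x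

open Classical in
/-- Repeated removal of non-root nodes without incoming edges; in a finite acyclic graph, exactly
the nodes that are reachable from the root survive. -/
noncomputable def prune (D : Diagram L V) : Diagram L V where
  node a := if D.Reach D.root a then D.node a else none
  root := D.root

/-- Redirect the edge labeled `ℓ` leaving `a` to the node `b`. -/
def redirectEdge (D : Diagram L V) (a : ℕ) (ℓ : Option Lbl) (b : ℕ) : Diagram L V where
  node := Function.update D.node a
    ((D.node a).map (Node.mapTargets fun ℓ' c => if ℓ' = ℓ then b else c))
  root := D.root

/-! ### Transformations -/

/-- Redundant node removal: the edge labeled `ℓ` from `n₁` to the redundant node is redirected to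
the successor `n₂` of that node, and nodes without incoming edges are removed. -/
noncomputable def bypass (D : Diagram L V) (n₁ : ℕ) (ℓ : Option Lbl) (n₂ : ℕ) : Diagram L V :=
  (D.redirectEdge n₁ ℓ n₂).prune

/-- Node replication: the edge labeled `ℓ` from `n₁` to `n` is redirected to a copy `n₂` of `n`
with the same outgoing edges. -/
def replicate (D : Diagram L V) (n₁ : ℕ) (ℓ : Option Lbl) (n n₂ : ℕ) : Diagram L V where
  node := Function.update (D.redirectEdge n₁ ℓ n₂).node n₂ (D.node n)
  root := D.root

/-- Replacement of the node `n` by a graph: `content x` is the node named `new x` of that graph (if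
any), edges to `n` are redirected to `entry`, and nodes without incoming edges are removed. -/
noncomputable def replace (D : Diagram L V) (n : ℕ) (new : Fin 3 × ℕ → ℕ)
    (content : Fin 3 × ℕ → Option (Node L V)) (entry : ℕ) : Diagram L V :=
  prune
    { node := Function.extend new content fun a =>
        (D.node a).map (Node.mapTargets fun _ c => if c = n then entry else c)
      root := D.root }

/-- `new` names nodes that are fresh for `D`. -/
def Fresh (D : Diagram L V) (new : Fin 3 × ℕ → ℕ) : Prop :=
  Function.Injective new ∧ ∀ x, new x ∉ D.nodes

end Diagram

/-! In the graphs below the row index is zero-based, and `n₁ n₂ n₃` are the targets of the edges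
`>`, `=`, `≱` of the node that is replaced. -/

/-- Graph with the single node `e ? 0` (KBO, different head symbols). -/
def kboNeGraph (e : LinExpr V) (a b c : ℕ) : Fin 3 × ℕ → Option (Node L V)
  | (0, 0) => some (.pos e a b c)
  | _ => none

/-- The entry of row `i` of a column of `k` nodes `new (col, i)`, which continues with `last`. -/
def rowId (new : Fin 3 × ℕ → ℕ) (col : Fin 3) (k last i : ℕ) : ℕ :=
  if i < k then new (col, i) else last

/-- KBO, equal head symbols: a node `e ? 0` (column 0) whose edge `≥` leads to the chain
`s₁ ? t₁`, ..., `s_k ? t_k` (column 1). -/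
def kboEqGraph (new : Fin 3 × ℕ → ℕ) (e : LinExpr V) {k : ℕ} (ss ts : Fin k → L.Term V)
    (n₁ n₂ n₃ : ℕ) : Fin 3 × ℕ → Option (Node L V)
  | (0, 0) => some (.pos e n₁ (rowId new 1 k n₂ 0) n₃)
  | (1, i) => if h : i < k then
      some (.comp (ss ⟨i, h⟩) (ts ⟨i, h⟩) n₁ (rowId new 1 k n₂ (i + 1)) n₃) else none
  | _ => none

/-- LPO, greater head symbol on the left: chain `s ? t₁`, ..., `s ? t_m` (column 0). -/
def lpoGtGraph (new : Fin 3 × ℕ → ℕ) (s : L.Term V) {m : ℕ} (ts : Fin m → L.Term V)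
    (n₁ n₃ : ℕ) : Fin 3 × ℕ → Option (Node L V)
  | (0, i) => if h : i < m then
      some (.comp s (ts ⟨i, h⟩) (rowId new 0 m n₁ (i + 1)) n₃ n₃) else none
  | _ => none

/-- LPO, greater head symbol on the right: chain `s₁ ? t`, ..., `s_k ? t` (column 2). -/
def lpoLtGraph (new : Fin 3 × ℕ → ℕ) {k : ℕ} (ss : Fin k → L.Term V) (t : L.Term V)
    (n₁ n₃ : ℕ) : Fin 3 × ℕ → Option (Node L V)
  | (2, i) => if h : i < k then
      some (.comp (ss ⟨i, h⟩) t n₁ n₁ (rowId new 2 k n₃ (i + 1))) else none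
  | _ => none

/-- LPO, equal head symbols: columns `s ? t_i` (column 0, rows 2 to k), `s_i ? t_i` (column 1,
rows 1 to k) and `s_i ? t` (column 2, rows 2 to k). -/
def lpoEqGraph (new : Fin 3 × ℕ → ℕ) (s t : L.Term V) {k : ℕ} (ss ts : Fin k → L.Term V)
    (n₁ n₂ n₃ : ℕ) : Fin 3 × ℕ → Option (Node L V)
  | (0, i) => if h : 0 < i ∧ i < k then
      some (.comp s (ts ⟨i, h.2⟩) (rowId new 0 k n₁ (i + 1)) n₃ n₃) else none
  | (1, i) => if h : i < k then
      some (.comp (ss ⟨i, h⟩) (ts ⟨i, h⟩)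
        (rowId new 0 k n₁ (i + 1)) (rowId new 1 k n₂ (i + 1)) (rowId new 2 k n₃ (i + 1))) else none
  | (2, i) => if h : 0 < i ∧ i < k then
      some (.comp (ss ⟨i, h.2⟩) t n₁ n₁ (rowId new 2 k n₃ (i + 1))) else none

/-- `OrderTransform wt ord D n D' n'`: some KBO or LPO transformation available for `ord`, applied
to the node `n` of `D`, yields `D'`, in which `n'` has taken the place of `n`. -/
inductive OrderTransform (wt : Sym L → ℕ) (ord : TermOrder L V) (D : Diagram L V) (n : ℕ) :
    Diagram L V → ℕ → Prop
  | kbo_gt (prec : Precedence L) (hord : ord = .kbo prec)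
      {k m : ℕ} (f : L.Functions k) (g : L.Functions m)
      (ss : Fin k → L.Term V) (ts : Fin m → L.Term V) (n₁ n₂ n₃ : ℕ)
      (hn : D.node n = some (.comp (.func f ss) (.func g ts) n₁ n₂ n₃))
      (hfg : prec.gt ⟨k, f⟩ ⟨m, g⟩) (new : Fin 3 × ℕ → ℕ) (hnew : D.Fresh new) :
      OrderTransform wt ord D n
        (D.replace n new (kboNeGraph (weight wt (.func f ss) - weight wt (.func g ts)) n₁ n₁ n₃)
          (new (0, 0))) (new (0, 0))
  | kbo_lt (prec : Precedence L) (hord : ord = .kbo prec)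
      {k m : ℕ} (f : L.Functions k) (g : L.Functions m)
      (ss : Fin k → L.Term V) (ts : Fin m → L.Term V) (n₁ n₂ n₃ : ℕ)
      (hn : D.node n = some (.comp (.func f ss) (.func g ts) n₁ n₂ n₃))
      (hfg : prec.gt ⟨m, g⟩ ⟨k, f⟩) (new : Fin 3 × ℕ → ℕ) (hnew : D.Fresh new) :
      OrderTransform wt ord D n
        (D.replace n new (kboNeGraph (weight wt (.func f ss) - weight wt (.func g ts)) n₁ n₃ n₃)
          (new (0, 0))) (new (0, 0))
  | kbo_eq (prec : Precedence L) (hord : ord = .kbo prec)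
      {k : ℕ} (f : L.Functions k) (ss ts : Fin k → L.Term V) (n₁ n₂ n₃ : ℕ)
      (hn : D.node n = some (.comp (.func f ss) (.func f ts) n₁ n₂ n₃))
      (new : Fin 3 × ℕ → ℕ) (hnew : D.Fresh new) :
      OrderTransform wt ord D n
        (D.replace n new (kboEqGraph new (weight wt (.func f ss) - weight wt (.func f ts)) ss ts
          n₁ n₂ n₃) (new (0, 0))) (new (0, 0))
  | lpo_gt (prec : Precedence L) (hord : ord = .lpo prec)
      {k m : ℕ} (f : L.Functions k) (g : L.Functions m)
      (ss : Fin k → L.Term V) (ts : Fin m → L.Term V) (n₁ n₂ n₃ : ℕ)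
      (hn : D.node n = some (.comp (.func f ss) (.func g ts) n₁ n₂ n₃))
      (hfg : prec.gt ⟨k, f⟩ ⟨m, g⟩) (new : Fin 3 × ℕ → ℕ) (hnew : D.Fresh new) :
      OrderTransform wt ord D n
        (D.replace n new (lpoGtGraph new (.func f ss) ts n₁ n₃) (rowId new 0 m n₁ 0))
        (rowId new 0 m n₁ 0)
  | lpo_lt (prec : Precedence L) (hord : ord = .lpo prec)
      {k m : ℕ} (f : L.Functions k) (g : L.Functions m)
      (ss : Fin k → L.Term V) (ts : Fin m → L.Term V) (n₁ n₂ n₃ : ℕ)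
      (hn : D.node n = some (.comp (.func f ss) (.func g ts) n₁ n₂ n₃))
      (hfg : prec.gt ⟨m, g⟩ ⟨k, f⟩) (new : Fin 3 × ℕ → ℕ) (hnew : D.Fresh new) :
      OrderTransform wt ord D n
        (D.replace n new (lpoLtGraph new ss (.func g ts) n₁ n₃) (rowId new 2 k n₃ 0))
        (rowId new 2 k n₃ 0)
  | lpo_eq (prec : Precedence L) (hord : ord = .lpo prec)
      {k : ℕ} (f : L.Functions k) (ss ts : Fin k → L.Term V) (n₁ n₂ n₃ : ℕ)
      (hn : D.node n = some (.comp (.func f ss) (.func f ts) n₁ n₂ n₃))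
      (new : Fin 3 × ℕ → ℕ) (hnew : D.Fresh new) :
      OrderTransform wt ord D n
        (D.replace n new (lpoEqGraph new (.func f ss) (.func f ts) ss ts n₁ n₂ n₃)
          (rowId new 1 k n₂ 0)) (rowId new 1 k n₂ 0)

/-! ### Evaluation, paths and forcing functions -/

open Classical in
/-- `σ(s ? t)`. -/
noncomputable def evalComp (wt : Sym L → ℕ) (ord : TermOrder L V) (σ : Subst L V)
    (s t : L.Term V) : Lbl :=
  if ord.gt wt (σ.app s) (σ.app t) then .gt else if σ.app s = σ.app t then .eq else .ngeq

open Classical in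
/-- `σ(e ? 0)`. -/
noncomputable def evalPos (wt : Sym L → ℕ) (σ : Subst L V) (e : LinExpr V) : Lbl :=
  if LinPos wt (σ.appLin wt e) then .gt
  else if LinNonneg wt (σ.appLin wt e) then .geq else .ngeq

/-- The label of the edge along which a traversal for `σ` leaves a node (`none` for the unlabeled
edge of a root or success node; irrelevant for the exit node). -/
noncomputable def Node.eval (wt : Sym L → ℕ) (ord : TermOrder L V) (σ : Subst L V) :
    Node L V → Option Lbl
  | .comp s t _ _ _ => some (evalComp wt ord σ s t)
  | .pos e _ _ _ => some (evalPos wt σ e)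
  | _ => none

/-- `D.IsPath p n`: there is a path in `D` from the root to `n` that passes, in this order, through
the nodes listed in `p`, leaving each of them by the edge with the listed label. -/
inductive Diagram.IsPath (D : Diagram L V) : List (ℕ × Option Lbl) → ℕ → Prop
  | root : D.IsPath [] D.root
  | snoc {p : List (ℕ × Option Lbl)} {a b : ℕ} {ℓ : Option Lbl}
      (hp : D.IsPath p a) (he : D.Edge a ℓ b) : D.IsPath (p ++ [(a, ℓ)]) b

/-- The path with the nodes and edge labels `p` is a `σ`-path: it leaves every evaluation node by
the edge whose label is the value of that node under `σ`. -/
def Diagram.IsSubstPath (wt : Sym L → ℕ) (ord : TermOrder L V) (σ : Subst L V) (D : Diagram L V)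
    (p : List (ℕ × Option Lbl)) : Prop :=
  ∀ x ∈ p, ∀ c, D.node x.1 = some c → c.IsEval → x.2 = c.eval wt ord σ

variable (L V) in
/-- A partial function from paths (in a diagram, from its root) to edge labels. -/
abbrev PathFun := Diagram L V → List (ℕ × Option Lbl) → ℕ → Option Lbl

/-- `F` is a forcing function: if its value on a path `n₀, ..., n_i` from the root of a TOD is `ℓ`,
then every `σ`-path `n₀, ..., n_i, n_{i+1}` (for every `σ`) ends with an edge labeled `ℓ`. -/
def IsForcing (wt : Sym L → ℕ) (ord : TermOrder L V) (F : PathFun L V) : Prop :=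
  ∀ D : Diagram L V, D.IsTOD → ∀ (σ : Subst L V) (p : List (ℕ × Option Lbl)) (a b : ℕ)
    (ℓ : Option Lbl), D.IsPath p a → D.Edge a ℓ b → D.IsSubstPath wt ord σ (p ++ [(a, ℓ)]) →
    ∀ ℓ', F D p a = some ℓ' → ℓ = some ℓ'

/-! ### The retrieval algorithm -/

/-- Retrieve all equalities, or stop at the first one. -/
inductive Mode
  | all | first

variable (L V) in
/-- Configurations of the algorithm. `running D visited p n`: the current diagram is `D`, its
visited nodes are `visited`, and the path `p` has been followed to the current node `n`.
`done D visited result`: the algorithm has terminated and returned `result`. -/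
inductive Config
  | running (D : Diagram L V) (visited : Set ℕ) (p : List (ℕ × Option Lbl)) (n : ℕ)
  | done (D : Diagram L V) (visited : Set ℕ) (result : Set (L.Term V × L.Term V))

/-- The non-deleted equalities in the success nodes on a path. -/
def Diagram.answers (D : Diagram L V) (deleted : Set (L.Term V × L.Term V))
    (p : List (ℕ × Option Lbl)) : Set (L.Term V × L.Term V) :=
  {q | q ∉ deleted ∧ ∃ x ∈ p, ∃ m, D.node x.1 = some (.success q.1 q.2 m)}

/-- `Isolate D a ℓ n D' n'`: if the current node `n`, reached by the edge labeled `ℓ` from `a`, has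
another incoming edge, then replicate it so that its copy `n'` in the new diagram `D'` is the
current node and has this incoming edge only; otherwise change nothing. -/
inductive Isolate (D : Diagram L V) (a : ℕ) (ℓ : Option Lbl) (n : ℕ) : Diagram L V → ℕ → Prop
  | single (h : ∀ b ℓ', D.Edge b ℓ' n → (b, ℓ') = (a, ℓ)) : Isolate D a ℓ n D n
  | multiple (n' : ℕ) (h : ∃ b ℓ', D.Edge b ℓ' n ∧ (b, ℓ') ≠ (a, ℓ)) (hn' : n' ∉ D.nodes) :
      Isolate D a ℓ n (D.replicate a ℓ n n') n'

/-- One step of the retrieval algorithm for the query substitution `σ`, with forcing function `F`.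
If both `redundant` and `transform` are possible, either may be chosen. -/
inductive Step (wt : Sym L → ℕ) (ord : TermOrder L V) (F : PathFun L V) (mode : Mode)
    (deleted : Set (L.Term V × L.Term V)) (σ : Subst L V) : Config L V → Config L V → Prop
  | exit (D : Diagram L V) (visited : Set ℕ) (p : List (ℕ × Option Lbl)) (n : ℕ)
      (hn : D.node n = some .exit) :
      Step wt ord F mode deleted σ (.running D visited p n) (.done D visited (D.answers deleted p))
  | success (D : Diagram L V) (visited : Set ℕ) (p : List (ℕ × Option Lbl)) (n : ℕ)
      (l r : L.Term V) (m : ℕ) (hn : D.node n = some (.success l r m))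
      (hmode : mode = .all ∨ (l, r) ∈ deleted) :
      Step wt ord F mode deleted σ (.running D visited p n)
        (.running D visited (p ++ [(n, none)]) m)
  | first (D : Diagram L V) (visited : Set ℕ) (p : List (ℕ × Option Lbl)) (n : ℕ)
      (l r : L.Term V) (m : ℕ) (hn : D.node n = some (.success l r m))
      (hmode : mode = .first) (hdel : (l, r) ∉ deleted) :
      Step wt ord F mode deleted σ (.running D visited p n) (.done D visited {(l, r)})
  | redundant (D : Diagram L V) (visited : Set ℕ) (p : List (ℕ × Option Lbl)) (a : ℕ)
      (ℓ : Option Lbl) (n : ℕ) (c : Node L V) (hn : D.node n = some c) (hc : c.IsEval)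
      (hvis : n ∉ visited) (D' : Diagram L V) (n' : ℕ) (hiso : Isolate D a ℓ n D' n')
      (b : Lbl) (hF : F D' (p ++ [(a, ℓ)]) n' = some b)
      (n₂ : ℕ) (hedge : D'.Edge n' (some b) n₂) :
      Step wt ord F mode deleted σ (.running D visited (p ++ [(a, ℓ)]) n)
        (.running (D'.bypass a ℓ n₂) (visited ∩ (D'.bypass a ℓ n₂).nodes) (p ++ [(a, ℓ)]) n₂)
  | transform (D : Diagram L V) (visited : Set ℕ) (p : List (ℕ × Option Lbl)) (a : ℕ)
      (ℓ : Option Lbl) (n : ℕ) (c : Node L V) (hn : D.node n = some c) (hc : c.IsEval)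
      (hvis : n ∉ visited) (D' : Diagram L V) (n' : ℕ) (hiso : Isolate D a ℓ n D' n')
      (D'' : Diagram L V) (n'' : ℕ) (htr : OrderTransform wt ord D' n' D'' n'') :
      Step wt ord F mode deleted σ (.running D visited (p ++ [(a, ℓ)]) n)
        (.running D'' (visited ∩ D''.nodes) (p ++ [(a, ℓ)]) n'')
  | mark (D : Diagram L V) (visited : Set ℕ) (p : List (ℕ × Option Lbl)) (a : ℕ)
      (ℓ : Option Lbl) (n : ℕ) (c : Node L V) (hn : D.node n = some c) (hc : c.IsEval)
      (hvis : n ∉ visited) (D' : Diagram L V) (n' : ℕ) (hiso : Isolate D a ℓ n D' n')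
      (hF : F D' (p ++ [(a, ℓ)]) n' = none)
      (htr : ¬ ∃ D'' n'', OrderTransform wt ord D' n' D'' n'') :
      Step wt ord F mode deleted σ (.running D visited (p ++ [(a, ℓ)]) n)
        (.running D' (insert n' visited) (p ++ [(a, ℓ)]) n')
  | follow (D : Diagram L V) (visited : Set ℕ) (p : List (ℕ × Option Lbl)) (n : ℕ)
      (c : Node L V) (hn : D.node n = some c) (hc : c.IsEval) (hvis : n ∈ visited)
      (m : ℕ) (hm : c.target (c.eval wt ord σ) = some m) :
      Step wt ord F mode deleted σ (.running D visited p n)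
        (.running D visited (p ++ [(n, c.eval wt ord σ)]) m)

/-- Retrieval starts in the successor `m` of the root. -/
inductive IsStart (D : Diagram L V) (visited : Set ℕ) : Config L V → Prop
  | mk (m : ℕ) (hm : D.node D.root = some (.root m)) :
      IsStart D visited (.running D visited [(D.root, none)] m)

end Diagrams

end TermOrderingDiagram

open TermOrderingDiagram

/-! The argument attaches to the current diagram a potential on its nodes that bounds the total cost
of every path starting at a node. A comparison `s ? t` costs `2 * |s| * |t|`, with `|·|` here the
number of symbols, and every other node costs 1. A term ordering diagram has such a potential
because it is finite and acyclic (`Diagram.IsTOD.exists_hasPotential`).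

The potential at the current node never grows, and it drops in every step except marking and
stopping. Following an edge or bypassing a node moves to a successor, which lies lower because costs
are positive; a replicated node inherits the potential of its original. The KBO and LPO
transformations are the substantial case. The terms compared on any path through the replacement
graph satisfy `∑ 2|s||t_j| ≤ 2|s||t| - 2`, or the mirror image of this, because the head symbol of
the decomposed term is lost. A gap of 2 pays for the positivity check of KBO and still leaves a
strict decrease (`Invariant.orderTransform`). Marking keeps the potential but turns an unvisited
node into a visited one, so `2 * pot n` plus 1 for an unvisited current node decreases in every step
that does not stop (`Invariant.step`).

These changes of the diagram only redirect edges into the current node, add evaluation nodes and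
prune. The nodes on the path already followed have larger potential than the current node, so that
path survives apart from its last edge (`Diagram.Modifies`). Hence the diagram remains a term
ordering diagram and the path remains a σ-path. This is what excludes stuck runs
(`Invariant.progress`): a forced label must agree with the value of the node under σ, and every
evaluation node has an edge with that label. -/

namespace TermOrderingDiagram

section Retrieval

variable {L : FirstOrder.Language.{u, v}} {V : Type w}

/-! ### Costs of nodes -/

/-- The number of symbols of a term. -/
def termSize : L.Term V → ℕ
  | .var _ => 1
  | .func _ ts => 1 + ∑ i, termSize (ts i)

theorem termSize_pos (t : L.Term V) : 0 < termSize t := by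
  cases t <;> simp only [termSize] <;> omega

/-- An upper bound for the number of diagram nodes that transformations of a node put on a path. -/
def Node.cost : Node L V → ℕ
  | .comp s t _ _ _ => 2 * (termSize s * termSize t)
  | _ => 1

theorem Node.cost_pos (c : Node L V) : 0 < c.cost := by
  cases c with
  | comp s t => exact Nat.mul_pos two_pos (Nat.mul_pos (termSize_pos s) (termSize_pos t))
  | _ => exact one_pos

theorem Node.target_mapTargets (c : Node L V) (φ : Option Lbl → ℕ → ℕ) (ℓ : Option Lbl) :
    (c.mapTargets φ).target ℓ = (c.target ℓ).map (φ ℓ) := by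
  rcases ℓ with _ | _ | _ | _ | _ <;> cases c <;> rfl

theorem Node.cost_mapTargets (c : Node L V) (φ : Option Lbl → ℕ → ℕ) :
    (c.mapTargets φ).cost = c.cost := by
  cases c <;> rfl

theorem Node.isEval_mapTargets (c : Node L V) (φ : Option Lbl → ℕ → ℕ) :
    (c.mapTargets φ).IsEval ↔ c.IsEval := by
  cases c <;> rfl

theorem Node.eval_mapTargets (wt : Sym L → ℕ) (ord : TermOrder L V) (σ : Subst L V)
    (c : Node L V) (φ : Option Lbl → ℕ → ℕ) :
    (c.mapTargets φ).eval wt ord σ = c.eval wt ord σ := by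
  cases c <;> rfl

theorem Node.mapTargets_eq_exit (c : Node L V) (φ : Option Lbl → ℕ → ℕ) :
    c.mapTargets φ = .exit ↔ c = .exit := by
  cases c <;> simp [Node.mapTargets]

theorem Node.exists_mapTargets_eq_root (c : Node L V) (φ : Option Lbl → ℕ → ℕ) :
    (∃ m, c.mapTargets φ = .root m) ↔ ∃ m, c = .root m := by
  cases c <;> simp [Node.mapTargets]

theorem Node.mapTargets_eq_self (c : Node L V) : c.mapTargets (fun _ z => z) = c := by
  cases c <;> rfl

/-- Every node but the exit node has an outgoing edge. -/
theorem Node.exists_target (c : Node L V) (hc : c ≠ .exit) : ∃ ℓ m, c.target ℓ = some m := by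
  cases c with
  | exit => exact absurd rfl hc
  | root m => exact ⟨none, m, rfl⟩
  | success _ _ m => exact ⟨none, m, rfl⟩
  | comp _ _ m => exact ⟨some .gt, m, rfl⟩
  | pos _ m => exact ⟨some .gt, m, rfl⟩

/-- An evaluation node has an edge labeled by its value. -/
theorem Node.IsEval.exists_target_eval (wt : Sym L → ℕ) (ord : TermOrder L V) (σ : Subst L V)
    {c : Node L V} (hc : c.IsEval) : ∃ m, c.target (c.eval wt ord σ) = some m := by
  cases c with
  | comp s t a b d =>
    simp only [Node.eval, evalComp]
    split_ifs <;> exact ⟨_, rfl⟩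
  | pos e a b d =>
    simp only [Node.eval, evalPos]
    split_ifs <;> exact ⟨_, rfl⟩
  | _ => exact hc.elim

/-! ### Potentials -/

/-- `D` satisfies the conditions on term ordering diagrams other than reachability, and `pot` bounds
the total cost of the nodes on the paths that start in a given node. -/
structure Diagram.HasPotential (D : Diagram L V) (pot : ℕ → ℕ) : Prop where
  finite : D.nodes.Finite
  step : ∀ x c, D.node x = some c → ∀ ℓ y, c.target ℓ = some y →
    y ∈ D.nodes ∧ c.cost + pot y ≤ pot x
  single_root : ∀ a, (∃ m, D.node a = some (.root m)) ↔ a = D.root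
  exit_unique : ∀ x y, D.node x = some .exit → D.node y = some .exit → x = y

theorem Diagram.mem_nodes_of_node {D : Diagram L V} {x : ℕ} {c : Node L V}
    (h : D.node x = some c) : x ∈ D.nodes := by
  simp [Diagram.nodes, h]

theorem Diagram.exists_node {D : Diagram L V} {x : ℕ} (h : x ∈ D.nodes) :
    ∃ c, D.node x = some c := Option.ne_none_iff_exists'.1 h

theorem Diagram.Edge.source_mem {D : Diagram L V} {a b : ℕ} {ℓ : Option Lbl}
    (h : D.Edge a ℓ b) : a ∈ D.nodes := by
  obtain ⟨c, hc, -⟩ := h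
  exact D.mem_nodes_of_node hc

namespace Diagram.HasPotential

variable {D : Diagram L V} {pot : ℕ → ℕ}

theorem lt_of_edge (h : D.HasPotential pot) {a b : ℕ} {ℓ : Option Lbl} (he : D.Edge a ℓ b) :
    pot b < pot a := by
  obtain ⟨c, hc, hb⟩ := he
  have := (h.step a c hc ℓ b hb).2
  have := c.cost_pos
  omega

theorem lt_of_adj (h : D.HasPotential pot) {a b : ℕ} (he : D.Adj a b) : pot b < pot a :=
  h.lt_of_edge he.choose_spec

theorem target_mem (h : D.HasPotential pot) {a b : ℕ} {ℓ : Option Lbl} (he : D.Edge a ℓ b) :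
    b ∈ D.nodes := by
  obtain ⟨c, hc, hb⟩ := he
  exact (h.step a c hc ℓ b hb).1

theorem lt_of_transGen (h : D.HasPotential pot) {a b : ℕ} (he : Relation.TransGen D.Adj a b) :
    pot b < pot a := by
  induction he with
  | single he => exact h.lt_of_adj he
  | tail _ he ih => exact (h.lt_of_adj he).trans ih

theorem le_of_reach (h : D.HasPotential pot) {a b : ℕ} (he : D.Reach a b) : pot b ≤ pot a := by
  induction he with
  | refl => exact le_rfl
  | tail _ he ih => exact (h.lt_of_adj he).le.trans ih

theorem root_mem (h : D.HasPotential pot) : D.root ∈ D.nodes := by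
  obtain ⟨m, hm⟩ := (h.single_root D.root).2 rfl
  exact D.mem_nodes_of_node hm

/-- Every node except an exit has an outgoing edge, and edges lower the potential, so following
arbitrary edges must end at an exit. -/
theorem exists_reach_exit (h : D.HasPotential pot) (a : ℕ) (ha : a ∈ D.nodes) :
    ∃ x, D.node x = some .exit ∧ D.Reach a x := by
  induction hk : pot a using Nat.strong_induction_on generalizing a with
  | _ k ih =>
    obtain ⟨c, hc⟩ := D.exists_node ha
    by_cases hex : c = .exit
    · exact ⟨a, hex ▸ hc, .refl⟩
    · obtain ⟨ℓ, m, hm⟩ := c.exists_target hex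
      have he : D.Edge a ℓ m := ⟨c, hc, hm⟩
      obtain ⟨x, hx, hr⟩ := ih (pot m) (hk ▸ h.lt_of_edge he) m (h.target_mem he) rfl
      exact ⟨x, hx, .head ⟨ℓ, he⟩ hr⟩

theorem isTOD (h : D.HasPotential pot) (hr : ∀ a ∈ D.nodes, D.Reach D.root a) : D.IsTOD where
  finite := h.finite
  closed a b := fun ⟨_, he⟩ => h.target_mem he
  acyclic a ha := lt_irrefl _ (h.lt_of_transGen ha)
  single_root := h.single_root
  reach_root := hr
  single_exit := by
    obtain ⟨x, hx, -⟩ := h.exists_reach_exit _ h.root_mem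
    exact ⟨x, hx, fun y hy => h.exit_unique y x hy hx⟩
  reach_exit a ha x hx := by
    obtain ⟨y, hy, hr⟩ := h.exists_reach_exit a ha
    rwa [h.exit_unique x y hx hy]

end Diagram.HasPotential

/-- The potential of a node is taken to be the total cost of all nodes reachable from it, which
avoids maximizing over paths. -/
theorem Diagram.IsTOD.exists_hasPotential {D : Diagram L V} (h : D.IsTOD) :
    ∃ pot, D.HasPotential pot := by
  classical
  let cost : ℕ → ℕ := fun y => ((D.node y).map Node.cost).getD 0
  let S : ℕ → Finset ℕ := fun x => h.finite.toFinset.filter (D.Reach x)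
  refine ⟨fun x => ∑ y ∈ S x, cost y, h.finite, fun x c hc ℓ y hy => ?_, h.single_root,
    fun x y hx hy => h.single_exit.unique hx hy⟩
  have hadj : D.Adj x y := ⟨ℓ, c, hc, hy⟩
  refine ⟨h.closed x y hadj, ?_⟩
  -- By acyclicity a node is not reachable from its successor, so its cost is counted in addition to
  -- those counted for the successor.
  have hx : x ∉ S y := fun hx =>
    h.acyclic x (Relation.TransGen.head' hadj (Finset.mem_filter.1 hx).2)
  have hsub : insert x (S y) ⊆ S x := by
    intro z hz
    rcases Finset.mem_insert.1 hz with rfl | hz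
    · exact Finset.mem_filter.2 ⟨by simpa using D.mem_nodes_of_node hc, .refl⟩
    · have := Finset.mem_filter.1 hz
      exact Finset.mem_filter.2 ⟨this.1, this.2.head hadj⟩
  calc c.cost + ∑ z ∈ S y, cost z = ∑ z ∈ insert x (S y), cost z := by
        rw [Finset.sum_insert hx]; simp [cost, hc]
    _ ≤ ∑ z ∈ S x, cost z := Finset.sum_le_sum_of_subset hsub

/-! ### Pruning -/

theorem Diagram.prune_node_eq_some {D : Diagram L V} {x : ℕ} {c : Node L V} :
    D.prune.node x = some c ↔ D.Reach D.root x ∧ D.node x = some c := by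
  simp only [Diagram.prune]
  split_ifs with h <;> simp [h]

theorem Diagram.Edge.prune {D : Diagram L V} {a b : ℕ} {ℓ : Option Lbl} (h : D.Edge a ℓ b)
    (ha : D.Reach D.root a) : D.prune.Edge a ℓ b := by
  obtain ⟨c, hc, hb⟩ := h
  exact ⟨c, Diagram.prune_node_eq_some.2 ⟨ha, hc⟩, hb⟩

/-- All nodes on a path from the root are themselves reachable, so pruning leaves the whole path
intact. -/
theorem Diagram.Reach.prune {D : Diagram L V} {a : ℕ} (h : D.Reach D.root a) :
    D.prune.Reach D.root a := by
  induction h with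
  | refl => exact .refl
  | tail hr he ih =>
    obtain ⟨ℓ, he⟩ := he
    exact ih.tail ⟨ℓ, he.prune hr⟩

theorem Diagram.prune_reach_root (D : Diagram L V) (a : ℕ) (ha : a ∈ D.prune.nodes) :
    D.prune.Reach D.prune.root a := by
  obtain ⟨c, hc⟩ := Diagram.exists_node ha
  exact (Diagram.prune_node_eq_some.1 hc).1.prune

theorem Diagram.HasPotential.prune {D : Diagram L V} {pot : ℕ → ℕ} (h : D.HasPotential pot) :
    D.prune.HasPotential pot where
  finite := h.finite.subset fun x hx => by
    obtain ⟨c, hc⟩ := Diagram.exists_node hx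
    exact D.mem_nodes_of_node (Diagram.prune_node_eq_some.1 hc).2
  step x c hc ℓ y hy := by
    obtain ⟨hr, hc⟩ := Diagram.prune_node_eq_some.1 hc
    obtain ⟨hm, hle⟩ := h.step x c hc ℓ y hy
    obtain ⟨d, hd⟩ := Diagram.exists_node hm
    exact ⟨Diagram.mem_nodes_of_node
      (Diagram.prune_node_eq_some.2 ⟨hr.tail ⟨ℓ, c, hc, hy⟩, hd⟩), hle⟩
  single_root a := by
    refine ⟨fun ⟨m, hm⟩ => (h.single_root a).1 ⟨m, (Diagram.prune_node_eq_some.1 hm).2⟩, ?_⟩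
    rintro rfl
    obtain ⟨m, hm⟩ := (h.single_root _).2 rfl
    exact ⟨m, Diagram.prune_node_eq_some.2 ⟨.refl, hm⟩⟩
  exit_unique x y hx hy := h.exit_unique x y (Diagram.prune_node_eq_some.1 hx).2
    (Diagram.prune_node_eq_some.1 hy).2

/-! ### Paths -/

theorem Diagram.IsPath.reach {D : Diagram L V} {p : List (ℕ × Option Lbl)} {a : ℕ}
    (h : D.IsPath p a) : D.Reach D.root a := by
  induction h with
  | root => exact .refl
  | snoc _ he ih => exact ih.tail ⟨_, he⟩

theorem Diagram.IsPath.prune {D : Diagram L V} {p : List (ℕ × Option Lbl)} {a : ℕ}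
    (h : D.IsPath p a) : D.prune.IsPath p a := by
  induction h with
  | root => exact .root (D := D.prune)
  | snoc hp he ih => exact ih.snoc (he.prune hp.reach)

theorem Diagram.IsPath.mem_nodes {D : Diagram L V} {p : List (ℕ × Option Lbl)} {a : ℕ}
    (h : D.IsPath p a) : ∀ x ∈ p, x.1 ∈ D.nodes := by
  induction h with
  | root => simp
  | snoc hp he ih =>
    intro x hx
    rcases List.mem_append.1 hx with hx | hx
    · exact ih x hx
    · rw [List.mem_singleton.1 hx]; exact he.source_mem

theorem Diagram.IsPath.exists_of_concat {D : Diagram L V} {p : List (ℕ × Option Lbl)} {a n : ℕ}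
    {ℓ : Option Lbl} (h : D.IsPath (p ++ [(a, ℓ)]) n) : D.IsPath p a ∧ D.Edge a ℓ n := by
  generalize hq : p ++ [(a, ℓ)] = q at h
  cases h with
  | root => simp at hq
  | snoc hp he =>
    obtain ⟨rfl, h⟩ := List.append_inj' hq rfl
    simp only [List.cons.injEq, Prod.mk.injEq, and_true] at h
    obtain ⟨rfl, rfl⟩ := h
    exact ⟨hp, he⟩

theorem Diagram.IsSubstPath.prune {wt : Sym L → ℕ} {ord : TermOrder L V} {σ : Subst L V}
    {D : Diagram L V} {p : List (ℕ × Option Lbl)} (h : D.IsSubstPath wt ord σ p) :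
    D.prune.IsSubstPath wt ord σ p :=
  fun x hx c hc => h x hx c (Diagram.prune_node_eq_some.1 hc).2

/-! ### Modifications of a diagram -/

/-- `D'` arises from `D` by redirecting edges to `n`, among them the edge labeled `ℓ` from `a`, which
goes to `n'` in `D'`, and by adding evaluation nodes; this does not increase potentials. -/
structure Diagram.Modifies (D : Diagram L V) (pot : ℕ → ℕ) (a : ℕ) (ℓ : Option Lbl) (n : ℕ)
    (D' : Diagram L V) (pot' : ℕ → ℕ) (n' : ℕ) : Prop where
  root_eq : D'.root = D.root
  finite : D'.nodes.Finite
  old : ∀ y c, D.node y = some c → pot' y = pot y ∧ ∃ φ : Option Lbl → ℕ → ℕ,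
    D'.node y = some (c.mapTargets φ) ∧
    (∀ ℓ' z, c.target ℓ' = some z →
      φ ℓ' z ∈ D'.nodes ∧ pot' (φ ℓ' z) ≤ pot z ∧ (z ≠ n → φ ℓ' z = z)) ∧
    (y = a → φ ℓ n = n')
  -- Since added nodes are evaluation nodes, no second root or exit can arise.
  new : ∀ y c, D.node y = none → D'.node y = some c → c.IsEval ∧
    ∀ ℓ' z, c.target ℓ' = some z → z ∈ D'.nodes ∧ c.cost + pot' z ≤ pot' y

namespace Diagram.Modifies

variable {D D' : Diagram L V} {pot pot' : ℕ → ℕ} {a n n' : ℕ} {ℓ : Option Lbl}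

/-- A redirected edge leads to a node of no larger potential than before, so the inequality at its
source persists; roots and exits are the old ones because redirection preserves the kind of a node.
-/
theorem hasPotential (h : D.Modifies pot a ℓ n D' pot' n') (hD : D.HasPotential pot) :
    D'.HasPotential pot' := by
  have key : ∀ y c', D'.node y = some c' → c'.IsEval ∨
      ∃ c φ, D.node y = some c ∧ c' = c.mapTargets φ := by
    intro y c' hc'
    cases hy : D.node y with
    | none => exact .inl (h.new y c' hy hc').1
    | some c =>
      obtain ⟨-, φ, hφ, -⟩ := h.old y c hy
      exact .inr ⟨c, φ, rfl, by simpa [hc'] using hφ⟩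
  refine ⟨h.finite, fun y c' hc' ℓ' z hz => ?_, fun y => ?_, fun x y hx hy => ?_⟩
  · cases hy : D.node y with
    | none => exact (h.new y c' hy hc').2 ℓ' z hz
    | some c =>
      obtain ⟨hpot, φ, hφ, hφ', -⟩ := h.old y c hy
      obtain rfl : c' = c.mapTargets φ := by simpa [hc'] using hφ
      rw [Node.target_mapTargets, Option.map_eq_some_iff] at hz
      obtain ⟨z', hz', rfl⟩ := hz
      have h₁ := hφ' ℓ' z' hz'
      have h₂ := hD.step y c hy ℓ' z' hz'
      refine ⟨h₁.1, ?_⟩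
      rw [Node.cost_mapTargets, hpot]
      omega
  · rw [h.root_eq, ← hD.single_root]
    constructor
    · rintro ⟨m, hm⟩
      rcases key y _ hm with h | ⟨c, φ, hc, hc'⟩
      · exact h.elim
      · obtain ⟨m', rfl⟩ := (c.exists_mapTargets_eq_root φ).1 ⟨m, hc'.symm⟩
        exact ⟨m', hc⟩
    · rintro ⟨m, hm⟩
      obtain ⟨-, φ, hφ, -⟩ := h.old y _ hm
      exact ⟨_, hφ⟩
  · have : ∀ x, D'.node x = some .exit → D.node x = some .exit := by
      intro x hx
      rcases key x _ hx with h | ⟨c, φ, hc, hc'⟩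
      · exact h.elim
      · rw [hc, (c.mapTargets_eq_exit φ).1 hc'.symm]
    exact hD.exit_unique x y (this x hx) (this y hy)

theorem edge_of_ne (h : D.Modifies pot a ℓ n D' pot' n') {y z : ℕ} {ℓ' : Option Lbl}
    (he : D.Edge y ℓ' z) (hz : z ≠ n) : D'.Edge y ℓ' z := by
  obtain ⟨c, hc, ht⟩ := he
  obtain ⟨-, φ, hφ, hφ', -⟩ := h.old y c hc
  exact ⟨_, hφ, by rw [Node.target_mapTargets, ht, Option.map_some, (hφ' ℓ' z ht).2.2 hz]⟩

theorem edge (h : D.Modifies pot a ℓ n D' pot' n') (he : D.Edge a ℓ n) : D'.Edge a ℓ n' := by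
  obtain ⟨c, hc, ht⟩ := he
  obtain ⟨-, φ, hφ, -, ha⟩ := h.old a c hc
  exact ⟨_, hφ, by rw [Node.target_mapTargets, ht, Option.map_some, ha rfl]⟩

/-- Potential decreases along the path, so all its nodes lie above `n`; none of its edges enters
`n`, and only such edges are changed. -/
theorem isPath_of_lt (h : D.Modifies pot a ℓ n D' pot' n') (hD : D.HasPotential pot)
    {p : List (ℕ × Option Lbl)} {b : ℕ} (hp : D.IsPath p b) (hb : pot n < pot b) :
    D'.IsPath p b := by
  induction hp with
  | root => rw [← h.root_eq]; exact .root
  | snoc hp he ih =>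
    exact (ih (hb.trans (hD.lt_of_edge he))).snoc (h.edge_of_ne he (by rintro rfl; omega))

theorem isPath (h : D.Modifies pot a ℓ n D' pot' n') (hD : D.HasPotential pot)
    {p : List (ℕ × Option Lbl)} (hp : D.IsPath (p ++ [(a, ℓ)]) n) :
    D'.IsPath (p ++ [(a, ℓ)]) n' := by
  obtain ⟨hp, he⟩ := hp.exists_of_concat
  exact (h.isPath_of_lt hD hp (hD.lt_of_edge he)).snoc (h.edge he)

theorem isSubstPath (h : D.Modifies pot a ℓ n D' pot' n') {wt : Sym L → ℕ} {ord : TermOrder L V}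
    {σ : Subst L V} {p : List (ℕ × Option Lbl)} (hp : D.IsSubstPath wt ord σ p)
    (hmem : ∀ x ∈ p, x.1 ∈ D.nodes) : D'.IsSubstPath wt ord σ p := by
  intro x hx c' hc' hev
  obtain ⟨c, hc⟩ := Diagram.exists_node (hmem x hx)
  obtain ⟨-, φ, hφ, -⟩ := h.old _ c hc
  obtain rfl : c' = c.mapTargets φ := by simpa [hc'] using hφ
  rw [Node.isEval_mapTargets] at hev
  rw [Node.eval_mapTargets]
  exact hp x hx c hc hev

end Diagram.Modifies

/-- What holds in every configuration: `p` is the path of the traversal for `σ` to the node `n` of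
the term ordering diagram `D`. -/
structure Invariant (wt : Sym L → ℕ) (ord : TermOrder L V) (σ : Subst L V) (D : Diagram L V)
    (pot : ℕ → ℕ) (p : List (ℕ × Option Lbl)) (n : ℕ) : Prop where
  hasPotential : D.HasPotential pot
  reach : ∀ a ∈ D.nodes, D.Reach D.root a
  isPath : D.IsPath p n
  isSubstPath : D.IsSubstPath wt ord σ p
  -- Keeps the current node away from the root and supplies the last edge, which isolation and
  -- bypassing redirect.
  ne_nil : p ≠ []

/-! ### Preservation and consequences of the traversal invariant -/

section

variable {wt : Sym L → ℕ} {ord : TermOrder L V} {σ : Subst L V} {D D' : Diagram L V}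
  {pot pot' : ℕ → ℕ} {p : List (ℕ × Option Lbl)} {a n n' : ℕ} {ℓ : Option Lbl}

theorem Invariant.modifies (hI : Invariant wt ord σ D pot (p ++ [(a, ℓ)]) n)
    (h : D.Modifies pot a ℓ n D' pot' n') (hr : ∀ a ∈ D'.nodes, D'.Reach D'.root a) :
    Invariant wt ord σ D' pot' (p ++ [(a, ℓ)]) n' :=
  ⟨h.hasPotential hI.hasPotential, hr, h.isPath hI.hasPotential hI.isPath,
    h.isSubstPath hI.isSubstPath hI.isPath.mem_nodes, hI.ne_nil⟩

theorem Invariant.modifies_prune (hI : Invariant wt ord σ D pot (p ++ [(a, ℓ)]) n)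
    (h : D.Modifies pot a ℓ n D' pot' n') :
    Invariant wt ord σ D'.prune pot' (p ++ [(a, ℓ)]) n' :=
  ⟨(h.hasPotential hI.hasPotential).prune, D'.prune_reach_root,
    (h.isPath hI.hasPotential hI.isPath).prune,
    (h.isSubstPath hI.isSubstPath hI.isPath.mem_nodes).prune, hI.ne_nil⟩

theorem Invariant.edge (hI : Invariant wt ord σ D pot (p ++ [(a, ℓ)]) n) : D.Edge a ℓ n :=
  hI.isPath.exists_of_concat.2

theorem Invariant.mem_nodes (hI : Invariant wt ord σ D pot p n) : n ∈ D.nodes := by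
  cases hI.isPath with
  | root => exact absurd rfl hI.ne_nil
  | snoc _ he => exact hI.hasPotential.target_mem he

/-- The last edge of the nonempty path would lower the potential into the root, yet the root reaches
the source of that edge and so has at least its potential. -/
theorem Invariant.ne_root (hI : Invariant wt ord σ D pot p n) (m : ℕ) :
    D.node n ≠ some (.root m) := by
  intro hm
  obtain rfl := (hI.hasPotential.single_root n).1 ⟨m, hm⟩
  cases h : hI.isPath with
  | root => exact hI.ne_nil rfl
  | snoc hp he =>
    exact absurd (hI.hasPotential.lt_of_edge he) (not_lt.2 (hI.hasPotential.le_of_reach hp.reach))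

theorem Invariant.snoc (hI : Invariant wt ord σ D pot p n) {c : Node L V}
    (hn : D.node n = some c) (hc : c.IsEval → ℓ = c.eval wt ord σ) {m : ℕ}
    (hm : c.target ℓ = some m) : Invariant wt ord σ D pot (p ++ [(n, ℓ)]) m where
  hasPotential := hI.hasPotential
  reach := hI.reach
  isPath := hI.isPath.snoc ⟨c, hn, hm⟩
  isSubstPath := by
    intro x hx c' hc' hev
    rcases List.mem_append.1 hx with hx | hx
    · exact hI.isSubstPath x hx c' hc' hev
    · obtain rfl := List.mem_singleton.1 hx
      obtain rfl : c = c' := by simpa [hn] using hc'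
      exact hc hev
  ne_nil := by simp

/-! ### The elementary transformations -/

theorem Diagram.redirectEdge_node {b y : ℕ} {c : Node L V} (hc : D.node y = some c) :
    (D.redirectEdge a ℓ b).node y =
      some (c.mapTargets fun ℓ' z => if y = a ∧ ℓ' = ℓ then b else z) := by
  by_cases hy : y = a
  · subst hy; simp [Diagram.redirectEdge, hc]
  · simp [Diagram.redirectEdge, hy, hc, Node.mapTargets_eq_self]

theorem Diagram.mem_redirectEdge_nodes {b y : ℕ} :
    y ∈ (D.redirectEdge a ℓ b).nodes ↔ y ∈ D.nodes := by
  by_cases hy : y = a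
  · subst hy; simp [Diagram.redirectEdge, Diagram.nodes]
  · simp [Diagram.redirectEdge, hy, Diagram.nodes]

theorem Diagram.HasPotential.modifies_redirectEdge (hD : D.HasPotential pot) (he : D.Edge a ℓ n)
    (hn' : n' ∈ D.nodes) (hle : pot n' ≤ pot n) :
    D.Modifies pot a ℓ n (D.redirectEdge a ℓ n') pot n' where
  root_eq := rfl
  finite := hD.finite.subset fun y hy => Diagram.mem_redirectEdge_nodes.1 hy
  old y c hc := by
    refine ⟨rfl, _, Diagram.redirectEdge_node hc, fun ℓ' z hz => ?_, fun hy => by simp [hy]⟩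
    simp only [Diagram.mem_redirectEdge_nodes]
    split_ifs with h
    · obtain ⟨rfl, rfl⟩ := h
      obtain ⟨c', hc', hz'⟩ := he
      obtain rfl : c = c' := by simpa [hc] using hc'
      obtain rfl : z = n := by simpa [hz] using hz'
      exact ⟨hn', hle, fun h => absurd rfl h⟩
    · exact ⟨(hD.step y c hc ℓ' z hz).1, le_rfl, fun _ => rfl⟩
  new y c hy hc := by
    exact absurd hy (Diagram.mem_redirectEdge_nodes.1 (Diagram.mem_nodes_of_node hc))

theorem Diagram.replicate_node {y : ℕ} {c : Node L V} (hy : y ≠ n') (hc : D.node y = some c) :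
    (D.replicate a ℓ n n').node y =
      some (c.mapTargets fun ℓ' z => if y = a ∧ ℓ' = ℓ then n' else z) := by
  rw [← Diagram.redirectEdge_node hc]
  simp [Diagram.replicate, hy]

theorem Diagram.replicate_node_self : (D.replicate a ℓ n n').node n' = D.node n := by
  simp [Diagram.replicate]

theorem Diagram.mem_replicate_nodes (hn : n ∈ D.nodes) {y : ℕ} :
    y ∈ (D.replicate a ℓ n n').nodes ↔ y ∈ D.nodes ∨ y = n' := by
  by_cases hy : y = n'
  · subst hy
    simpa [Diagram.replicate, Diagram.nodes] using hn
  · rw [← Diagram.mem_redirectEdge_nodes (D := D) (a := a) (ℓ := ℓ) (b := n')]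
    simp [Diagram.replicate, hy, Diagram.nodes]

/-- The copy has the same cost and successors as `n`, so it can be given the same potential. -/
theorem Diagram.HasPotential.modifies_replicate (hD : D.HasPotential pot) (he : D.Edge a ℓ n)
    (hn' : n' ∉ D.nodes) {c : Node L V} (hn : D.node n = some c) (hc : c.IsEval) :
    D.Modifies pot a ℓ n (D.replicate a ℓ n n') (Function.update pot n' (pot n)) n' := by
  have hmem := D.mem_nodes_of_node hn
  have hpot : ∀ y ∈ D.nodes, Function.update pot n' (pot n) y = pot y := fun y hy =>
    Function.update_of_ne (by rintro rfl; exact hn' hy) _ _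
  refine ⟨rfl, (hD.finite.union (Set.finite_singleton n')).subset fun y hy =>
    (Diagram.mem_replicate_nodes hmem).1 hy, fun y d hd => ?_, fun y d hy hd => ?_⟩
  · have hy := D.mem_nodes_of_node hd
    refine ⟨hpot y hy, _, Diagram.replicate_node (fun h => hn' (h ▸ hy)) hd,
      fun ℓ' z hz => ?_, fun hy => by simp [hy]⟩
    simp only [Diagram.mem_replicate_nodes hmem]
    split_ifs with h
    · obtain ⟨rfl, rfl⟩ := h
      obtain ⟨c', hc', hz'⟩ := he
      obtain rfl : d = c' := by simpa [hd] using hc'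
      obtain rfl : z = n := by simpa [hz] using hz'
      exact ⟨.inr rfl, by simp, fun h => absurd rfl h⟩
    · have := (hD.step y d hd ℓ' z hz).1
      exact ⟨.inl this, (hpot z this).le, fun _ => rfl⟩
  · rcases (Diagram.mem_replicate_nodes hmem).1 (Diagram.mem_nodes_of_node hd) with h | rfl
    · exact absurd hy h
    · rw [Diagram.replicate_node_self, hn, Option.some.injEq] at hd
      subst hd
      refine ⟨hc, fun ℓ' z hz => ?_⟩
      have := hD.step n c hn ℓ' z hz
      rw [Diagram.mem_replicate_nodes hmem, hpot z this.1, Function.update_self]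
      exact ⟨.inl this.1, this.2⟩

/-- Replication is not followed by pruning, so the original must stay reachable. This is why a copy
is made only if there is another incoming edge. -/
theorem Invariant.isolate (hI : Invariant wt ord σ D pot (p ++ [(a, ℓ)]) n) {c : Node L V}
    (hn : D.node n = some c) (hc : c.IsEval) (h : Isolate D a ℓ n D' n') :
    D'.node n' = some c ∧
      ∃ pot', pot' n' = pot n ∧ Invariant wt ord σ D' pot' (p ++ [(a, ℓ)]) n' := by
  cases h with
  | single => exact ⟨hn, pot, rfl, hI⟩
  | multiple _ h hn' =>
    have hD := hI.hasPotential
    have hM := hD.modifies_replicate hI.edge hn' hn hc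
    refine ⟨Diagram.replicate_node_self.trans hn, _, Function.update_self .., hI.modifies hM ?_⟩
    have hedge : ∀ b ℓ' z, D.Edge b ℓ' z → (b, ℓ') ≠ (a, ℓ) →
        (D.replicate a ℓ n n').Edge b ℓ' z := by
      rintro b ℓ' z ⟨d, hd, hz⟩ hne
      refine ⟨_, Diagram.replicate_node (fun h => hn' (h ▸ D.mem_nodes_of_node hd)) hd, ?_⟩
      rw [Node.target_mapTargets, hz, Option.map_some, if_neg (by simpa using hne)]
    -- A path to a node above `n` cannot use an edge into `n`, hence is unaffected by the
    -- redirection.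
    have hreach : ∀ b, D.Reach D.root b → pot n < pot b → (D.replicate a ℓ n n').Reach D.root b := by
      intro b hb
      induction hb with
      | refl => exact fun _ => .refl
      | tail _ he ih =>
        intro hlt
        obtain ⟨ℓ', he⟩ := he
        exact (ih (hlt.trans (hD.lt_of_edge he))).tail
          ⟨ℓ', hM.edge_of_ne he (by rintro rfl; omega)⟩
    -- The other incoming edge of `n` is untouched, and its source lies above `n`.
    have hrn : (D.replicate a ℓ n n').Reach D.root n := by
      obtain ⟨b, ℓ', he, hne⟩ := h
      exact (hreach b (hI.reach b he.source_mem) (hD.lt_of_edge he)).tail ⟨ℓ', hedge b ℓ' n he hne⟩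
    have hall : ∀ b, D.Reach D.root b → (D.replicate a ℓ n n').Reach D.root b := by
      intro b hb
      induction hb with
      | refl => exact .refl
      | @tail y z _ he ih =>
        obtain ⟨ℓ', he⟩ := he
        by_cases hz : z = n
        · rw [hz]; exact hrn
        · exact ih.tail ⟨ℓ', hM.edge_of_ne he hz⟩
    intro b hb
    rcases (Diagram.mem_replicate_nodes hI.mem_nodes).1 hb with hb | rfl
    · exact hall b (hI.reach b hb)
    · exact (hreach a (hI.reach a hI.edge.source_mem) (hD.lt_of_edge hI.edge)).tail
        ⟨ℓ, hM.edge hI.edge⟩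

theorem Invariant.bypass (hI : Invariant wt ord σ D pot (p ++ [(a, ℓ)]) n) {ℓ' : Option Lbl}
    (he : D.Edge n ℓ' n') : Invariant wt ord σ (D.bypass a ℓ n') pot (p ++ [(a, ℓ)]) n' :=
  hI.modifies_prune (hI.hasPotential.modifies_redirectEdge hI.edge
    (hI.hasPotential.target_mem he) (hI.hasPotential.lt_of_edge he).le)

/-- In the diagram `D` with additional nodes `new x` for `content x`, which have potential `q x`,
the node `z` exists and has potential at most `B`. -/
def Diagram.BoundedTarget (D : Diagram L V) (pot : ℕ → ℕ) (new : Fin 3 × ℕ → ℕ)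
    (content : Fin 3 × ℕ → Option (Node L V)) (q : Fin 3 × ℕ → ℕ) (B z : ℕ) : Prop :=
  (z ∈ D.nodes ∨ ∃ y, content y ≠ none ∧ z = new y) ∧ Function.extend new q pot z ≤ B

/-- Reduces each transformation to local bookkeeping: a potential `q` on the new nodes that pays for
each node's cost plus a common bound on its targets, and an entry strictly below `n`. Old nodes keep
their potential. -/
theorem Invariant.replace (hI : Invariant wt ord σ D pot (p ++ [(a, ℓ)]) n)
    {new : Fin 3 × ℕ → ℕ} (hnew : D.Fresh new) {content : Fin 3 × ℕ → Option (Node L V)}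
    {entry : ℕ} (q : Fin 3 × ℕ → ℕ) (hfin : {x | content x ≠ none}.Finite)
    (hcontent : ∀ x c, content x = some c → c.IsEval ∧ ∃ B, c.cost + B ≤ q x ∧
      ∀ ℓ' z, c.target ℓ' = some z → D.BoundedTarget pot new content q B z)
    {B : ℕ} (hB : B < pot n) (hentry : D.BoundedTarget pot new content q B entry) :
    Function.extend new q pot entry < pot n ∧
    Invariant wt ord σ (D.replace n new content entry) (Function.extend new q pot)
      (p ++ [(a, ℓ)]) entry := by
  have hold : ∀ y ∈ D.nodes, ¬ ∃ x, new x = y := by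
    rintro _ hy ⟨x, rfl⟩
    exact hnew.2 x hy
  have hD := hI.hasPotential
  obtain ⟨hmem, hentry⟩ := hentry
  replace hentry := hentry.trans_lt hB
  refine ⟨hentry, hI.modifies_prune ?_⟩
  have hnodes : ∀ y, y ∈ D.nodes ∨ (∃ x, content x ≠ none ∧ y = new x) →
      Function.extend new content (fun a => (D.node a).map
        (Node.mapTargets fun _ c => if c = n then entry else c)) y ≠ none := by
    rintro y (hy | ⟨x, hx, rfl⟩)
    · rw [Function.extend_apply' _ _ _ (hold y hy)]
      simpa [Diagram.nodes] using hy
    · rwa [hnew.1.extend_apply]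
  refine ⟨rfl, (hD.finite.union (hfin.image new)).subset fun y hy => ?_,
    fun y c hc => ?_, fun y c hy hc => ?_⟩
  · by_cases hx : ∃ x, new x = y
    · obtain ⟨x, rfl⟩ := hx
      refine .inr ⟨x, ?_, rfl⟩
      simpa [Diagram.nodes, hnew.1.extend_apply] using hy
    · left
      simpa [Diagram.nodes, Function.extend_apply' _ _ _ hx] using hy
  · have hy := hold y (D.mem_nodes_of_node hc)
    refine ⟨Function.extend_apply' _ _ _ hy, fun _ z => if z = n then entry else z,
      by dsimp only; rw [Function.extend_apply' _ _ _ hy, hc, Option.map_some], fun ℓ' z hz => ?_, fun _ => by simp⟩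
    dsimp only
    split_ifs with h
    · subst h
      exact ⟨hnodes _ hmem, hentry.le, fun h => absurd rfl h⟩
    · have := (hD.step y c hc ℓ' z hz).1
      exact ⟨hnodes _ (.inl this), (Function.extend_apply' _ _ _ (hold z this)).le, fun _ => rfl⟩
  · by_cases hx : ∃ x, new x = y
    · obtain ⟨x, rfl⟩ := hx
      dsimp only at hc
      rw [hnew.1.extend_apply] at hc
      obtain ⟨hev, B', hB', hc⟩ := hcontent x c hc
      refine ⟨hev, fun ℓ' z hz => ?_⟩
      obtain ⟨h₁, h₂⟩ := hc ℓ' z hz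
      rw [hnew.1.extend_apply]
      exact ⟨hnodes z h₁, by omega⟩
    · dsimp only at hc
      rw [Function.extend_apply' _ _ _ hx, hy] at hc
      simp at hc

end

/-! ### The transformations for KBO and LPO -/

/-- The sum of `f j` for `i ≤ j`. -/
def tailSum {k : ℕ} (f : Fin k → ℕ) (i : ℕ) : ℕ := ∑ j : Fin k, if i ≤ j then f j else 0

theorem tailSum_eq_add {k : ℕ} (f : Fin k → ℕ) {i : ℕ} (h : i < k) :
    tailSum f i = f ⟨i, h⟩ + tailSum f (i + 1) := by
  have : f ⟨i, h⟩ = ∑ j : Fin k, if j = ⟨i, h⟩ then f j else 0 := by simp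
  rw [this, tailSum, tailSum, ← Finset.sum_add_distrib]
  refine Finset.sum_congr rfl fun j _ => ?_
  simp only [Fin.ext_iff]
  split_ifs <;> omega

theorem tailSum_zero {k : ℕ} (f : Fin k → ℕ) : tailSum f 0 = ∑ j, f j := by
  simp [tailSum]

theorem tailSum_mono {k : ℕ} {f g : Fin k → ℕ} (h : ∀ j, f j ≤ g j) (i : ℕ) :
    tailSum f i ≤ tailSum g i := by
  refine Finset.sum_le_sum fun j _ => ?_
  split_ifs
  exacts [h j, le_rfl]

/-- The head symbol `g` contributes 1 to the size, so the arguments leave a gap of `2 * termSize s`,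
which is at least 2. -/
theorem tailSum_right_lt (s : L.Term V) {m : ℕ} (g : L.Functions m) (ts : Fin m → L.Term V) :
    tailSum (fun j => 2 * (termSize s * termSize (ts j))) 0 + 2 ≤
      2 * (termSize s * termSize (.func g ts : L.Term V)) := by
  have := termSize_pos s
  rw [tailSum_zero, ← Finset.mul_sum, ← Finset.mul_sum, termSize, mul_add, mul_one]
  omega

theorem tailSum_left_lt {k : ℕ} (f : L.Functions k) (ss : Fin k → L.Term V) (t : L.Term V) :
    tailSum (fun j => 2 * (termSize (ss j) * termSize t)) 0 + 2 ≤
      2 * (termSize (.func f ss : L.Term V) * termSize t) := by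
  simpa only [mul_comm] using tailSum_right_lt t f ss

theorem termSize_arg_le {k : ℕ} (f : L.Functions k) (ss : Fin k → L.Term V) (i : Fin k) :
    termSize (ss i) ≤ termSize (.func f ss : L.Term V) := by
  have := Finset.single_le_sum (f := fun j => termSize (ss j)) (fun _ _ => Nat.zero_le _)
    (Finset.mem_univ i)
  rw [termSize]
  omega

theorem Node.forall_target_comp {s t : L.Term V} {a b c : ℕ} {P : ℕ → Prop} (ha : P a) (hb : P b)
    (hc : P c) (ℓ : Option Lbl) (z : ℕ) (h : (Node.comp s t a b c).target ℓ = some z) : P z := by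
  rcases ℓ with _ | _ | _ | _ | _ <;> simp only [Node.target, Option.some.injEq, reduceCtorEq] at h
  all_goals (subst h; assumption)

theorem Node.forall_target_pos {e : LinExpr V} {a b c : ℕ} {P : ℕ → Prop} (ha : P a) (hb : P b)
    (hc : P c) (ℓ : Option Lbl) (z : ℕ)
    (h : (Node.pos e a b c : Node L V).target ℓ = some z) : P z := by
  rcases ℓ with _ | _ | _ | _ | _ <;> simp only [Node.target, Option.some.injEq, reduceCtorEq] at h
  all_goals (subst h; assumption)

theorem finite_of_row_lt {α : Type*} {content : Fin 3 × ℕ → Option α} (k : ℕ)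
    (h : ∀ x, content x ≠ none → x.2 < k) : {x | content x ≠ none}.Finite :=
  (Set.finite_univ.prod (Set.finite_Iio k)).subset fun x hx => ⟨Set.mem_univ _, h x hx⟩

section

variable {D : Diagram L V} {pot : ℕ → ℕ} {new : Fin 3 × ℕ → ℕ}
  {content : Fin 3 × ℕ → Option (Node L V)} {q : Fin 3 × ℕ → ℕ} {B : ℕ}

theorem Diagram.Fresh.boundedTarget_old (hnew : D.Fresh new) {z : ℕ} (hz : z ∈ D.nodes)
    (hB : pot z ≤ B) : D.BoundedTarget pot new content q B z := by
  refine ⟨.inl hz, ?_⟩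
  rwa [Function.extend_apply']
  rintro ⟨x, rfl⟩
  exact hnew.2 x hz

theorem Diagram.Fresh.boundedTarget_new (hnew : D.Fresh new) {x : Fin 3 × ℕ}
    (hx : content x ≠ none) (hB : q x ≤ B) : D.BoundedTarget pot new content q B (new x) :=
  ⟨.inr ⟨x, hx, rfl⟩, by rwa [hnew.1.extend_apply]⟩

theorem Diagram.Fresh.boundedTarget_rowId (hnew : D.Fresh new) {col : Fin 3} {k last i : ℕ}
    (hlast : last ∈ D.nodes) (hle : pot last ≤ B)
    (h : i < k → content (col, i) ≠ none ∧ q (col, i) ≤ B) :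
    D.BoundedTarget pot new content q B (rowId new col k last i) := by
  rw [rowId]
  split_ifs with hi
  · exact hnew.boundedTarget_new (h hi).1 (h hi).2
  · exact hnew.boundedTarget_old hlast hle

end

/-! ### Decrease of the potential for each replacement graph -/

section

variable {wt : Sym L → ℕ} {ord : TermOrder L V} {σ : Subst L V} {D D' : Diagram L V}
  {pot : ℕ → ℕ} {p : List (ℕ × Option Lbl)} {a n n' : ℕ} {ℓ : Option Lbl}

theorem Invariant.exists_bound (hI : Invariant wt ord σ D pot p n) {s t : L.Term V}
    {n₁ n₂ n₃ : ℕ} (hn : D.node n = some (.comp s t n₁ n₂ n₃)) :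
    ∃ N, N + 2 * (termSize s * termSize t) ≤ pot n ∧ (n₁ ∈ D.nodes ∧ pot n₁ ≤ N) ∧
      (n₂ ∈ D.nodes ∧ pot n₂ ≤ N) ∧ n₃ ∈ D.nodes ∧ pot n₃ ≤ N := by
  have h₁ := hI.hasPotential.step n _ hn (some .gt) n₁ rfl
  have h₂ := hI.hasPotential.step n _ hn (some .eq) n₂ rfl
  have h₃ := hI.hasPotential.step n _ hn (some .ngeq) n₃ rfl
  simp only [Node.cost] at h₁ h₂ h₃
  -- The subtraction is not truncated: the cost of `n` is part of `pot n` by `h₁`.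
  exact ⟨pot n - 2 * (termSize s * termSize t), by omega, ⟨h₁.1, by omega⟩, ⟨h₂.1, by omega⟩,
    h₃.1, by omega⟩

theorem Invariant.replace_kboNeGraph (hI : Invariant wt ord σ D pot (p ++ [(a, ℓ)]) n)
    {s t : L.Term V} {n₁ n₂ n₃ m : ℕ} (hn : D.node n = some (.comp s t n₁ n₂ n₃))
    {new : Fin 3 × ℕ → ℕ} (hnew : D.Fresh new) (e : LinExpr V) (hm : m = n₁ ∨ m = n₃) :
    ∃ pot', pot' (new (0, 0)) < pot n ∧
      Invariant wt ord σ (D.replace n new (kboNeGraph e n₁ m n₃) (new (0, 0))) pot'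
        (p ++ [(a, ℓ)]) (new (0, 0)) := by
  obtain ⟨N, hN, ⟨hm₁, hN₁⟩, -, hm₃, hN₃⟩ := hI.exists_bound hn
  have hW := Nat.mul_pos (termSize_pos s) (termSize_pos t)
  -- The check costs 1 and the comparison it replaces at least 2; this is one place where the factor
  -- 2 in `Node.cost` is needed.
  refine ⟨_, hI.replace hnew (fun _ => N + 1) (finite_of_row_lt 1 ?_) ?_
    (show N + 1 < pot n by omega) (hnew.boundedTarget_new (by simp [kboNeGraph]) le_rfl)⟩
  · intro x hx
    unfold kboNeGraph at hx
    split at hx <;> simp_all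
  · intro x c hc
    unfold kboNeGraph at hc
    split at hc
    · obtain rfl := Option.some.inj hc
      refine ⟨trivial, N, by simp [Node.cost, add_comm], Node.forall_target_pos
        (hnew.boundedTarget_old hm₁ hN₁) ?_ (hnew.boundedTarget_old hm₃ hN₃)⟩
      rcases hm with rfl | rfl
      exacts [hnew.boundedTarget_old hm₁ hN₁, hnew.boundedTarget_old hm₃ hN₃]
    · simp at hc

theorem Invariant.replace_kboEqGraph (hI : Invariant wt ord σ D pot (p ++ [(a, ℓ)]) n)
    {k : ℕ} {f : L.Functions k} {ss ts : Fin k → L.Term V} {n₁ n₂ n₃ : ℕ}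
    (hn : D.node n = some (.comp (.func f ss) (.func f ts) n₁ n₂ n₃))
    {new : Fin 3 × ℕ → ℕ} (hnew : D.Fresh new) (e : LinExpr V) :
    ∃ pot', pot' (new (0, 0)) < pot n ∧
      Invariant wt ord σ (D.replace n new (kboEqGraph new e ss ts n₁ n₂ n₃) (new (0, 0))) pot'
        (p ++ [(a, ℓ)]) (new (0, 0)) := by
  obtain ⟨N, hN, ⟨hm₁, hN₁⟩, ⟨hm₂, hN₂⟩, hm₃, hN₃⟩ := hI.exists_bound hn
  let A : ℕ → ℕ := tailSum fun j => 2 * (termSize (ss j) * termSize (ts j))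
  -- Enlarging each `s_j` to the whole left term reduces to `tailSum_right_lt`. One unit of the gap
  -- pays for the check node, the other gives strictness.
  have hA : A 0 + 2 ≤ 2 * (termSize (.func f ss : L.Term V) * termSize (.func f ts : L.Term V)) :=
    (Nat.add_le_add_right (tailSum_mono (fun j => Nat.mul_le_mul_left 2
      (Nat.mul_le_mul_right _ (termSize_arg_le f ss j))) 0) 2).trans
      (tailSum_right_lt (.func f ss) f ts)
  -- A chain node at row `i` has potential `N` plus the cost of the chain from there on. The row
  -- bound is `k + 1` because the check node occupies row 0 even for constants.
  refine ⟨_, hI.replace hnew (fun x => if x.1 = 0 then N + A 0 + 1 else N + A x.2)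
    (finite_of_row_lt (k + 1) ?_) ?_ (show N + A 0 + 1 < pot n by omega)
    (hnew.boundedTarget_new (by simp [kboEqGraph]) (by simp))⟩
  · rintro x hx
    unfold kboEqGraph at hx
    split at hx
    · exact Nat.succ_pos k
    · split_ifs at hx with h
      · exact h.trans (Nat.lt_succ_self k)
      · simp at hx
    · simp at hx
  · intro x c hc
    unfold kboEqGraph at hc
    split at hc
    · obtain rfl := Option.some.inj hc
      refine ⟨trivial, N + A 0, by simp [Node.cost, add_comm], Node.forall_target_pos
        (hnew.boundedTarget_old hm₁ (by omega)) ?_ (hnew.boundedTarget_old hm₃ (by omega))⟩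
      exact hnew.boundedTarget_rowId hm₂ (by omega)
        fun h => ⟨by simp [kboEqGraph, h], by simp⟩
    · rename_i i
      split_ifs at hc with h
      obtain rfl := Option.some.inj hc
      have hAi : A i = _ := tailSum_eq_add _ h
      refine ⟨trivial, N + A (i + 1), by simp [Node.cost, hAi, A]; omega, Node.forall_target_comp
        (hnew.boundedTarget_old hm₁ (by omega)) ?_ (hnew.boundedTarget_old hm₃ (by omega))⟩
      exact hnew.boundedTarget_rowId hm₂ (by omega)
        fun h => ⟨by simp [kboEqGraph, h], by simp⟩
    · simp at hc

/-- A path visits at most the chain `s ? t_j`, whose total cost is below that of `s ? t`; for `m =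
0` the entry is `n₁` itself. -/
theorem Invariant.replace_lpoGtGraph (hI : Invariant wt ord σ D pot (p ++ [(a, ℓ)]) n)
    {s : L.Term V} {m : ℕ} {g : L.Functions m} {ts : Fin m → L.Term V} {n₁ n₂ n₃ : ℕ}
    (hn : D.node n = some (.comp s (.func g ts) n₁ n₂ n₃))
    {new : Fin 3 × ℕ → ℕ} (hnew : D.Fresh new) :
    ∃ pot', pot' (rowId new 0 m n₁ 0) < pot n ∧
      Invariant wt ord σ (D.replace n new (lpoGtGraph new s ts n₁ n₃) (rowId new 0 m n₁ 0)) pot'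
        (p ++ [(a, ℓ)]) (rowId new 0 m n₁ 0) := by
  obtain ⟨N, hN, ⟨hm₁, hN₁⟩, -, hm₃, hN₃⟩ := hI.exists_bound hn
  let A : ℕ → ℕ := tailSum fun j => 2 * (termSize s * termSize (ts j))
  have hA : A 0 + 2 ≤ _ := tailSum_right_lt s g ts
  refine ⟨_, hI.replace hnew (fun x => N + A x.2) (finite_of_row_lt m ?_) ?_
    (show N + A 0 < pot n by omega) (hnew.boundedTarget_rowId hm₁ (by omega)
      fun h => ⟨by simp [lpoGtGraph, h], le_rfl⟩)⟩
  · rintro x hx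
    unfold lpoGtGraph at hx
    split at hx
    · split_ifs at hx with h
      · exact h
      · simp at hx
    · simp at hx
  · intro x c hc
    unfold lpoGtGraph at hc
    split at hc
    · rename_i i
      split_ifs at hc with h
      obtain rfl := Option.some.inj hc
      have hAi : A i = _ := tailSum_eq_add _ h
      have h₃ : D.BoundedTarget pot new (lpoGtGraph new s ts n₁ n₃) (fun x => N + A x.2)
        (N + A (i + 1)) n₃ := hnew.boundedTarget_old hm₃ (by omega)
      refine ⟨trivial, N + A (i + 1), by simp [Node.cost, hAi, A]; omega, Node.forall_target_comp
        ?_ h₃ h₃⟩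
      exact hnew.boundedTarget_rowId hm₁ (by omega) fun h => ⟨by simp [lpoGtGraph, h], le_rfl⟩
    · simp at hc

theorem Invariant.replace_lpoLtGraph (hI : Invariant wt ord σ D pot (p ++ [(a, ℓ)]) n)
    {t : L.Term V} {k : ℕ} {f : L.Functions k} {ss : Fin k → L.Term V} {n₁ n₂ n₃ : ℕ}
    (hn : D.node n = some (.comp (.func f ss) t n₁ n₂ n₃))
    {new : Fin 3 × ℕ → ℕ} (hnew : D.Fresh new) :
    ∃ pot', pot' (rowId new 2 k n₃ 0) < pot n ∧
      Invariant wt ord σ (D.replace n new (lpoLtGraph new ss t n₁ n₃) (rowId new 2 k n₃ 0)) pot'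
        (p ++ [(a, ℓ)]) (rowId new 2 k n₃ 0) := by
  obtain ⟨N, hN, ⟨hm₁, hN₁⟩, -, hm₃, hN₃⟩ := hI.exists_bound hn
  let C : ℕ → ℕ := tailSum fun j => 2 * (termSize (ss j) * termSize t)
  have hC : C 0 + 2 ≤ _ := tailSum_left_lt f ss t
  refine ⟨_, hI.replace hnew (fun x => N + C x.2) (finite_of_row_lt k ?_) ?_
    (show N + C 0 < pot n by omega) (hnew.boundedTarget_rowId hm₃ (by omega)
      fun h => ⟨by simp [lpoLtGraph, h], le_rfl⟩)⟩
  · rintro x hx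
    unfold lpoLtGraph at hx
    split at hx
    · split_ifs at hx with h
      · exact h
      · simp at hx
    · simp at hx
  · intro x c hc
    unfold lpoLtGraph at hc
    split at hc
    · rename_i i
      split_ifs at hc with h
      obtain rfl := Option.some.inj hc
      have hCi : C i = _ := tailSum_eq_add _ h
      have h₁ : D.BoundedTarget pot new (lpoLtGraph new ss t n₁ n₃) (fun x => N + C x.2)
        (N + C (i + 1)) n₁ := hnew.boundedTarget_old hm₁ (by omega)
      refine ⟨trivial, N + C (i + 1), by simp [Node.cost, hCi, C]; omega, Node.forall_target_comp
        h₁ h₁ ?_⟩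
      exact hnew.boundedTarget_rowId hm₃ (by omega) fun h => ⟨by simp [lpoLtGraph, h], le_rfl⟩
    · simp at hc

/-- A path descends the middle column and may switch once to an outer column, where it stays. A
middle node `s_i ? t_i` costs no more than either outer node `s ? t_i` or `s_i ? t` of its row, so
the maximum of the two outer chain costs bounds every path. -/
theorem Invariant.replace_lpoEqGraph (hI : Invariant wt ord σ D pot (p ++ [(a, ℓ)]) n)
    {k : ℕ} {f : L.Functions k} {ss ts : Fin k → L.Term V} {n₁ n₂ n₃ : ℕ}
    (hn : D.node n = some (.comp (.func f ss) (.func f ts) n₁ n₂ n₃))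
    {new : Fin 3 × ℕ → ℕ} (hnew : D.Fresh new) :
    ∃ pot', pot' (rowId new 1 k n₂ 0) < pot n ∧
      Invariant wt ord σ (D.replace n new
        (lpoEqGraph new (.func f ss) (.func f ts) ss ts n₁ n₂ n₃) (rowId new 1 k n₂ 0)) pot'
        (p ++ [(a, ℓ)]) (rowId new 1 k n₂ 0) := by
  obtain ⟨N, hN, ⟨hm₁, hN₁⟩, ⟨hm₂, hN₂⟩, hm₃, hN₃⟩ := hI.exists_bound hn
  have hs := termSize_arg_le f ss
  have ht := termSize_arg_le f ts
  have hA₀ := tailSum_right_lt (.func f ss) f ts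
  have hC₀ := tailSum_left_lt f ss (.func f ts)
  generalize (FirstOrder.Language.Term.func f ss : L.Term V) = s at *
  generalize (FirstOrder.Language.Term.func f ts : L.Term V) = t at *
  let A : ℕ → ℕ := tailSum fun j => 2 * (termSize s * termSize (ts j))
  let C : ℕ → ℕ := tailSum fun j => 2 * (termSize (ss j) * termSize t)
  let q : Fin 3 × ℕ → ℕ := fun x =>
    N + if x.1 = 0 then A x.2 else if x.1 = 1 then max (A x.2) (C x.2) else C x.2
  have hq₀ : ∀ i, q (0, i) = N + A i := fun i => by simp [q]
  have hq₁ : ∀ i, q (1, i) = N + max (A i) (C i) := fun i => by simp [q]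
  have hq₂ : ∀ i, q (2, i) = N + C i := fun i => by simp [q]
  refine ⟨_, hI.replace hnew q (finite_of_row_lt k ?_) ?_
    (show N + max (A 0) (C 0) < pot n by simp only [A, C]; omega)
    (hnew.boundedTarget_rowId hm₂ (by omega)
      fun h => ⟨by simp [lpoEqGraph, h], (hq₁ 0).le⟩)⟩
  · rintro x hx
    unfold lpoEqGraph at hx
    split at hx
    · split_ifs at hx with h
      · exact h.2
      · simp at hx
    · split_ifs at hx with h
      · exact h
      · simp at hx
    · split_ifs at hx with h
      · exact h.2
      · simp at hx
  · intro x c hc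
    have h₀ : ∀ i B, N + A (i + 1) ≤ B → D.BoundedTarget pot new
        (lpoEqGraph new s t ss ts n₁ n₂ n₃) q B (rowId new 0 k n₁ (i + 1)) := fun i B hB =>
      hnew.boundedTarget_rowId hm₁ (by omega)
        fun h => ⟨by simp [lpoEqGraph, h], (hq₀ _).trans_le hB⟩
    have h₂ : ∀ i B, N + C (i + 1) ≤ B → D.BoundedTarget pot new
        (lpoEqGraph new s t ss ts n₁ n₂ n₃) q B (rowId new 2 k n₃ (i + 1)) := fun i B hB =>
      hnew.boundedTarget_rowId hm₃ (by omega)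
        fun h => ⟨by simp [lpoEqGraph, h], (hq₂ _).trans_le hB⟩
    unfold lpoEqGraph at hc
    split at hc
    · rename_i i
      split_ifs at hc with h
      obtain rfl := Option.some.inj hc
      have hAi : A i = 2 * (termSize s * termSize (ts ⟨i, h.2⟩)) + A (i + 1) := tailSum_eq_add _ h.2
      rw [hq₀]
      exact ⟨trivial, N + A (i + 1), by simp only [Node.cost]; omega, Node.forall_target_comp
        (h₀ i _ le_rfl) (hnew.boundedTarget_old hm₃ (by omega))
        (hnew.boundedTarget_old hm₃ (by omega))⟩
    · rename_i i
      split_ifs at hc with h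
      obtain rfl := Option.some.inj hc
      have hAi : A i = 2 * (termSize s * termSize (ts ⟨i, h⟩)) + A (i + 1) := tailSum_eq_add _ h
      have hCi : C i = 2 * (termSize (ss ⟨i, h⟩) * termSize t) + C (i + 1) := tailSum_eq_add _ h
      -- With these two bounds the cost of the middle node fits into the decrease of both `A` and
      -- `C` from row `i` to `i + 1`, hence into that of their maximum.
      have hs := Nat.mul_le_mul_right (termSize (ts ⟨i, h⟩)) (hs ⟨i, h⟩)
      have ht := Nat.mul_le_mul_left (termSize (ss ⟨i, h⟩)) (ht ⟨i, h⟩)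
      rw [hq₁]
      exact ⟨trivial, N + max (A (i + 1)) (C (i + 1)), by simp only [Node.cost]; omega,
        Node.forall_target_comp (h₀ i _ (by omega))
        (hnew.boundedTarget_rowId hm₂ (by omega) fun h => ⟨by simp [lpoEqGraph, h], (hq₁ _).le⟩)
        (h₂ i _ (by omega))⟩
    · rename_i i
      split_ifs at hc with h
      obtain rfl := Option.some.inj hc
      have hCi : C i = 2 * (termSize (ss ⟨i, h.2⟩) * termSize t) + C (i + 1) := tailSum_eq_add _ h.2
      rw [hq₂]
      exact ⟨trivial, N + C (i + 1), by simp only [Node.cost]; omega, Node.forall_target_comp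
        (hnew.boundedTarget_old hm₁ (by omega)) (hnew.boundedTarget_old hm₁ (by omega))
        (h₂ i _ le_rfl)⟩

theorem Invariant.orderTransform (hI : Invariant wt ord σ D pot (p ++ [(a, ℓ)]) n)
    (h : OrderTransform wt ord D n D' n') :
    ∃ pot', pot' n' < pot n ∧ Invariant wt ord σ D' pot' (p ++ [(a, ℓ)]) n' := by
  cases h with
  | kbo_gt prec _ f g ss ts n₁ n₂ n₃ hn _ new hnew =>
    exact hI.replace_kboNeGraph hn hnew _ (.inl rfl)
  | kbo_lt prec _ f g ss ts n₁ n₂ n₃ hn _ new hnew =>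
    exact hI.replace_kboNeGraph hn hnew _ (.inr rfl)
  | kbo_eq prec _ f ss ts n₁ n₂ n₃ hn new hnew => exact hI.replace_kboEqGraph hn hnew _
  | lpo_gt prec _ f g ss ts n₁ n₂ n₃ hn _ new hnew => exact hI.replace_lpoGtGraph hn hnew
  | lpo_lt prec _ f g ss ts n₁ n₂ n₃ hn _ new hnew => exact hI.replace_lpoLtGraph hn hnew
  | lpo_eq prec _ f ss ts n₁ n₂ n₃ hn new hnew => exact hI.replace_lpoEqGraph hn hnew

/-! ### Termination and progress -/

theorem Diagram.HasPotential.exists_isolate (hD : D.HasPotential pot) (a : ℕ) (ℓ : Option Lbl)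
    (n : ℕ) : ∃ D' n', Isolate D a ℓ n D' n' := by
  by_cases h : ∀ b ℓ', D.Edge b ℓ' n → (b, ℓ') = (a, ℓ)
  · exact ⟨D, n, .single h⟩
  · push Not at h
    obtain ⟨n', hn'⟩ := hD.finite.exists_notMem
    exact ⟨_, n', .multiple n' h hn'⟩

open Classical in
/-- The measure that decreases in each step of the retrieval algorithm. -/
noncomputable def retrievalMeasure (pot : ℕ → ℕ) (visited : Set ℕ) (n : ℕ) : ℕ :=
  2 * pot n + if n ∈ visited then 0 else 1

/-- The factor 2 lets a drop of the potential outweigh any change in the visited status of the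
current node. -/
theorem retrievalMeasure_lt_of_lt {pot pot' : ℕ → ℕ} {visited visited' : Set ℕ} {n n' : ℕ}
    (h : pot' n' < pot n) : retrievalMeasure pot' visited' n' < retrievalMeasure pot visited n := by
  unfold retrievalMeasure
  split_ifs <;> omega

variable {F : PathFun L V} {mode : Mode} {deleted : Set (L.Term V × L.Term V)} {visited : Set ℕ}

theorem Invariant.step (hI : Invariant wt ord σ D pot p n) {c : Config L V}
    (h : Step wt ord F mode deleted σ (.running D visited p n) c) :
    (∃ D' visited' result, c = .done D' visited' result) ∨
      ∃ D' visited' p' n' pot', c = .running D' visited' p' n' ∧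
        Invariant wt ord σ D' pot' p' n' ∧
        retrievalMeasure pot' visited' n' < retrievalMeasure pot visited n := by
  cases h with
  | exit => exact .inl ⟨_, _, _, rfl⟩
  | first => exact .inl ⟨_, _, _, rfl⟩
  | success _ _ _ _ l r m hn =>
    exact .inr ⟨_, _, _, _, pot, rfl, hI.snoc hn (fun h => h.elim) rfl,
      retrievalMeasure_lt_of_lt
        (hI.hasPotential.lt_of_edge (ℓ := none) ⟨_, hn, rfl⟩)⟩
  | redundant _ _ _ a ℓ _ d hn hd _ D' n' hiso b _ n₂ hedge =>
    obtain ⟨-, pot', hpot', hI'⟩ := hI.isolate hn hd hiso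
    exact .inr ⟨_, _, _, _, pot', rfl, hI'.bypass hedge,
      retrievalMeasure_lt_of_lt (hpot' ▸ hI'.hasPotential.lt_of_edge hedge)⟩
  | transform _ _ _ a ℓ _ d hn hd _ D' n' hiso D'' n'' htr =>
    obtain ⟨-, pot', hpot', hI'⟩ := hI.isolate hn hd hiso
    obtain ⟨pot'', hlt, hI''⟩ := hI'.orderTransform htr
    exact .inr ⟨_, _, _, _, pot'', rfl, hI'', retrievalMeasure_lt_of_lt (hpot' ▸ hlt)⟩
  | mark _ _ _ a ℓ _ d hn hd hvis D' n' hiso =>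
    obtain ⟨-, pot', hpot', hI'⟩ := hI.isolate hn hd hiso
    refine .inr ⟨_, _, _, _, pot', rfl, hI', ?_⟩
    simp [retrievalMeasure, hpot', hvis]
  | follow _ _ _ _ d hn hd _ m hm =>
    exact .inr ⟨_, _, _, _, pot, rfl, hI.snoc hn (fun _ => rfl) hm,
      retrievalMeasure_lt_of_lt (hI.hasPotential.lt_of_edge ⟨_, hn, hm⟩)⟩

/-- The delicate case is a forced label: a priori the node might have no edge with it. Forcing
applies because the diagram is still a term ordering diagram and the path is still a σ-path. -/
theorem Invariant.progress (hF : IsForcing wt ord F) (hI : Invariant wt ord σ D pot p n) :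
    ∃ c, Step wt ord F mode deleted σ (.running D visited p n) c := by
  obtain ⟨c, hn⟩ := Diagram.exists_node hI.mem_nodes
  by_cases hc : c.IsEval
  · by_cases hvis : n ∈ visited
    · obtain ⟨m, hm⟩ := hc.exists_target_eval wt ord σ
      exact ⟨_, .follow D visited p n c hn hc hvis m hm⟩
    · obtain ⟨q, ⟨a, ℓ⟩, rfl⟩ := (List.eq_nil_or_concat p).resolve_left hI.ne_nil
      simp only [List.concat_eq_append] at *
      obtain ⟨D', n', hiso⟩ := hI.hasPotential.exists_isolate a ℓ n
      by_cases htr : ∃ D'' n'', OrderTransform wt ord D' n' D'' n''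
      · obtain ⟨D'', n'', htr⟩ := htr
        exact ⟨_, .transform D visited q a ℓ n c hn hc hvis D' n' hiso D'' n'' htr⟩
      · cases hFv : F D' (q ++ [(a, ℓ)]) n' with
        | none => exact ⟨_, .mark D visited q a ℓ n c hn hc hvis D' n' hiso hFv htr⟩
        | some b =>
          obtain ⟨hn', pot', -, hI'⟩ := hI.isolate hn hc hiso
          obtain ⟨m, hm⟩ := hc.exists_target_eval wt ord σ
          -- Extending the path by the edge that σ selects gives a σ-path, so the forced label is
          -- that of an existing edge.
          have hb := hF D' (hI'.hasPotential.isTOD hI'.reach) σ _ n' m _ hI'.isPath ⟨c, hn', hm⟩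
            (hI'.snoc hn' (fun _ => rfl) hm).isSubstPath b hFv
          exact ⟨_, .redundant D visited q a ℓ n c hn hc hvis D' n' hiso b hFv m
            ⟨c, hn', hb ▸ hm⟩⟩
  · cases c with
    | root m => exact absurd hn (hI.ne_root m)
    | exit => exact ⟨_, .exit D visited p n hn⟩
    | comp => exact absurd trivial hc
    | pos => exact absurd trivial hc
    | success l r m =>
      cases mode with
      | all => exact ⟨_, .success D visited p n l r m hn (.inl rfl)⟩
      | first =>
        by_cases hdel : (l, r) ∈ deleted
        · exact ⟨_, .success D visited p n l r m hn (.inr hdel)⟩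
        · exact ⟨_, .first D visited p n l r m hn rfl hdel⟩

theorem not_step_done {result : Set (L.Term V × L.Term V)} (c : Config L V) :
    ¬ Step wt ord F mode deleted σ (.done D visited result) c := nofun

/-- The potential is not determined by the configuration but is chosen anew at each step, so the
induction runs over the value of the measure for all diagrams and potentials at once. -/
theorem Invariant.acc (hI : Invariant wt ord σ D pot p n) :
    Acc (fun c' c => Step wt ord F mode deleted σ c c') (.running D visited p n) := by
  induction hk : retrievalMeasure pot visited n using Nat.strong_induction_on
    generalizing D pot p n visited with
  | _ k ih =>
    refine ⟨_, fun c hc => ?_⟩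
    rcases hI.step hc with ⟨D', v, r, rfl⟩ | ⟨D', v, p', n', pot', rfl, hI', hlt⟩
    · exact ⟨_, fun c' hc' => absurd hc' (not_step_done c')⟩
    · exact ih _ (hk ▸ hlt) hI' rfl

/-- A configuration that has stopped or satisfies the invariant. -/
def Config.Good (wt : Sym L → ℕ) (ord : TermOrder L V) (σ : Subst L V) : Config L V → Prop
  | .running D _ p n => ∃ pot, Invariant wt ord σ D pot p n
  | .done _ _ _ => True

theorem Config.Good.step {c c' : Config L V} (h : c.Good wt ord σ)
    (hstep : Step wt ord F mode deleted σ c c') : c'.Good wt ord σ := by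
  cases c with
  | done => exact absurd hstep (not_step_done c')
  | running D visited p n =>
    obtain ⟨pot, hI⟩ := h
    rcases hI.step hstep with ⟨D', v, r, rfl⟩ | ⟨D', v, p', n', pot', rfl, hI', -⟩
    exacts [trivial, ⟨pot', hI'⟩]

theorem Config.Good.reflTransGen {c c' : Config L V} (h : c.Good wt ord σ)
    (hsteps : Relation.ReflTransGen (Step wt ord F mode deleted σ) c c') : c'.Good wt ord σ := by
  induction hsteps with
  | refl => exact h
  | tail _ hstep ih => exact ih.step hstep

theorem IsStart.good (hD : D.IsTOD) {c : Config L V} (h : IsStart D visited c) :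
    c.Good wt ord σ := by
  obtain ⟨m, hm⟩ := h
  obtain ⟨pot, hpot⟩ := hD.exists_hasPotential
  -- The initial path contains only the root, which is no evaluation node, so the σ-path condition
  -- is vacuous.
  refine ⟨pot, hpot, hD.reach_root, .snoc (p := []) .root ⟨_, hm, rfl⟩, ?_, by simp⟩
  intro x hx c hc hev
  obtain rfl := List.mem_singleton.1 hx
  obtain rfl : _ = c := by simpa [hm] using hc
  exact hev.elim

end

end Retrieval

end TermOrderingDiagram

/-- The retrieval algorithm terminates: it has no infinite run, and a run can only end by returning
a result (it never gets stuck). The diagram may carry marks from earlier retrievals. -/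
theorem mainTheorem2 {L : FirstOrder.Language.{u, v}} {V : Type w}
    (wt : Sym L → ℕ) (ord : TermOrder L V) (F : PathFun L V) (hF : IsForcing wt ord F)
    (mode : Mode) (deleted : Set (L.Term V × L.Term V)) (σ : Subst L V)
    (D : Diagram L V) (hD : D.IsTOD) (visited : Set ℕ) (hvisited : visited ⊆ D.nodes)
    (start : Config L V) (hstart : IsStart D visited start) :
    (¬ ∃ run : ℕ → Config L V, run 0 = start ∧
      ∀ i, Step wt ord F mode deleted σ (run i) (run (i + 1))) ∧
    ∀ c, Relation.ReflTransGen (Step wt ord F mode deleted σ) start c →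
      (∀ c', ¬ Step wt ord F mode deleted σ c c') →
        ∃ D' visited' result, c = .done D' visited' result := by
  have hgood : start.Good wt ord σ := hstart.good hD
  constructor
  · rintro ⟨run, rfl, hrun⟩
    -- An accessible configuration cannot occur in an infinite run, since its successor in the run
    -- would be accessible and occur as well.
    have hnot : ∀ c : Config L V, Acc (fun c' c => Step wt ord F mode deleted σ c c') c →
        ∀ i, run i ≠ c := by
      intro c hc
      induction hc with
      | intro c _ ih => exact fun i hi => ih (run (i + 1)) (hi ▸ hrun i) (i + 1) rfl
    generalize hs : run 0 = start at *
    obtain ⟨m, hm⟩ := hstart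
    obtain ⟨pot, hI⟩ := hgood
    exact hnot _ hI.acc 0 hs
  · intro c hc hstuck
    have := hgood.reflTransGen hc
    cases c with
    | done D' v r => exact ⟨D', v, r, rfl⟩
    | running D' v p n =>
      obtain ⟨pot, hI⟩ := this
      obtain ⟨c', hc'⟩ := hI.progress hF
      exact absurd hc' (hstuck c')
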